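/- Let $m,N\ge 1$ and $M=mN$. The periodic Bogoyavlensky lattice is the system $$\dot z_k=z_k\Big(\sum_{j=1}^{m-1}z_{k+j}-\sum_{j=1}^{m-1}z_{k-j}\Big),\qquad k\in\mathbb Z/M\mathbb Z,$$ for real variables $z_k$, with the Poisson bracket $\{z_j,z_k\}=c_{jk}z_jz_k$, where $c_{jk}$ is the number of $i\in\{1,\dots,m-1\}$ with $j\equiv k+i$ minus the number of such $i$ with $k\equiv j+i$ (mod $M$). So for $N\ge2$, $c_{jk}$ is $1$ if $j-k\equiv 1,\dots,m-1$, $-1$ if $j-k\equiv -1,\dots,-(m-1)$, and $0$ otherwise; for $N=1$ all $c_{jk}$ vanish. Let $g$ be the twisted loop algebra of all formal series $u(\lambda)=\sum_p\lambda^p\sum_{i-j\equiv p\,(\mathrm{mod}\,N)}u^{(p)}_{ij}E_{ij}$ with real coefficients, $1\le i,j\le N$, in which $p\in\mathbb Z$ is bounded above, with $\langle u,v\rangle=\mathrm{tr}(uv)_0$, where $(\cdot)_0$ is the coefficient of $\lambda^0$. Let $P_+,P_-,P_0$ be the projections of $g$ onto positive powers, negative powers and the free term, $R_0=P_+-P_-$,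 and let $\Pi=\Pi\circ P_0$ be given by $\Pi(E_{jj})=\sum_k\pi_{jk}E_{kk}$ with $\pi_{jk}=1,-1,0$ for $j>k$, $j<k$, $j=k$. Put $A=\frac12(R_0+\Pi)$, $D=\frac12(R_0-\Pi)$, $B=\frac12(P_0-\Pi)$, $C=\frac12(P_0+\Pi)$ and $R=A+B=C+D=\frac12(R_0+P_0)$. A function $\varphi:g\to\mathbb R$ is called smooth if it is $C^\infty$ on every finite-dimensional affine subspace and has at each $u$ a gradient $\nabla\varphi(u)\in g$, that is, $\langle\nabla\varphi(u),X\rangle=\frac{d}{d\varepsilon}\varphi(u+\varepsilon X)|_{\varepsilon=0}$ for all $X\in g$. With $d\varphi(u)=u\,\nabla\varphi(u)$ and $d'\varphi(u)=\nabla\varphi(u)\,u$, the bracket $\mathrm{PB}(A,B,C,D)$ is $$\{\varphi,\psi\}(u)=\langle A(d'\varphi),d'\psi\rangle-\langle D(d\varphi),d\psi\rangle+\langle B(d\varphi),d'\psi\rangle-\langle C(d'\varphi),d\psi\rangle,$$ and the Hamiltonian vector field of $\varphi$ is $X_\varphi(u)=uA(d'\varphi)-D(d\varphi)u+uB(d\varphi)-C(d'\varphi)u$.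 Let $v^{(j)}_k=z_{m(k-1)+j}$ for $1\le j\le m$, $1\le k\le N$. With matrix indices modulo $N$ let $$U_1(\lambda)=\lambda\sum_{k=1}^NE_{k+1,k}+\sum_{k=1}^Nv^{(1)}_kE_{kk},\qquad V_j(\lambda)=I+\lambda^{-1}\sum_{k=1}^Nv^{(j)}_kE_{k,k+1}\quad(2\le j\le m),$$ $$L_j(\lambda)=V_j\cdots V_2\,U_1\,V_m\cdots V_{j+1}\qquad(1\le j\le m),$$ and with matrix indices modulo $M$ let $T(\lambda)=\lambda^{-m+1}\sum_{k=1}^Mz_kE_{k,k+m-1}+\lambda\sum_{k=1}^ME_{k+1,k}$. Then the following holds. 1) For each $j$ the matrices $L_j$ form a Poisson submanifold of $g$ with the bracket $\mathrm{PB}(A,B,C,D)$, parametrized by the phase space of the lattice. That is: the map $z\mapsto L_j$ takes values in matrices involving a bounded range of powers of $\lambda$ independent of $z$; it is smooth, and an immersion on a dense open set; it is a Poisson map, $\{\varphi\circ L_j,\psi\circ L_j\}(z)=\{\varphi,\psi\}(L_j(z))$ for all smooth $\varphi,\psi$ on $g$ and all $z$, the bracket on the left being that of the lattice; and for each smooth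 $\varphi$ and each $z$ the vector $X_\varphi(L_j(z))$ is tangent to the family, being the derivative of $z\mapsto L_j$ in the direction $(\{\varphi\circ L_j,z_b\})_b$. 2) The lattice admits the $m$ equivalent Lax representations $$\dot L_j=[L_j,R(L_j)],\qquad 1\le j\le m.$$ That is: along every solution all these equations hold; there is a dense open set of $z$ such that, for each $j$ and for each differentiable curve $z(t)$, whenever $z(t)$ lies in that set, the $j$-th Lax equation holds at the time $t$ if and only if the lattice equations hold at the time $t$; and the Lax representations are gauge equivalent: with $W_1=U_1$, $W_j=V_j$ for $j\ge2$ and $L_0=L_m$, each $W_j$ is invertible in $g$, $L_jW_j=W_jL_{j-1}$, and along solutions $\dot W_j=W_jR(L_{j-1})-R(L_j)W_j$. 3) For all $j$, all real $\lambda\neq0$ and all real $\mu$ the number $\det(L_j(\lambda)-\mu I_N)$ is an integral of motion of the lattice (its time derivative vanishes along solutions), and $$\det\big(T^m(\lambda)-\mu I_M\big)=\prod_{j=1}^m\det\big(L_j(\lambda^m)-\mu I_N\big),$$ all the factors on the right being equal. These identities hold for $z_k$, $\mu$ and invertible $\lambda$ in an arbitrary commutative ring. -/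

import Mathlib

open scoped ContDiff

noncomputable section

namespace Bogoyavlensky

/-! ### The twisted loop algebra -/

/-- The coefficientwise action of the real numbers on Laurent series. -/
instance laurentAlgebra : Algebra ℝ (LaurentSeries ℝ) := HahnSeries.instAlgebra

/-- Coefficient of `λ ^ p` of a formal series in `λ` with finitely many positive powers. Such series
are Laurent series in the variable `λ⁻¹`. -/
def lamCoeff (p : ℤ) (f : LaurentSeries ℝ) : ℝ := f.coeff (-p)

/-- The spectral parameter `λ` as a unit of the field of Laurent series in `λ⁻¹`. -/
def lam : (LaurentSeries ℝ)ˣ where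
  val := HahnSeries.single (-1) 1
  inv := HahnSeries.single 1 1
  val_inv := by simp
  inv_val := by simp

/-- The twist: in the entry `(i, j)` only the powers `λ ^ p` with `i - j ≡ p (mod N)` occur. -/
def Twisted (N : ℕ) (i j : Fin N) (f : LaurentSeries ℝ) : Prop :=
  ∀ p : ℤ, ¬ ((i : ℤ) - (j : ℤ) ≡ p [ZMOD N]) → lamCoeff p f = 0

theorem Twisted.add {N : ℕ} {i j : Fin N} {f g : LaurentSeries ℝ}
    (hf : Twisted N i j f) (hg : Twisted N i j g) : Twisted N i j (f + g) := by
  intro p hp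
  have h1 := hf p hp
  have h2 := hg p hp
  simp only [lamCoeff] at h1 h2 ⊢
  simp [h1, h2]

theorem Twisted.zero {N : ℕ} (i j : Fin N) : Twisted N i j 0 := by
  intro p _
  simp [lamCoeff]

theorem Twisted.sum {N : ℕ} {ι : Type*} (s : Finset ι) {i j : Fin N} {f : ι → LaurentSeries ℝ}
    (hf : ∀ k ∈ s, Twisted N i j (f k)) : Twisted N i j (∑ k ∈ s, f k) :=
  Finset.sum_induction f (Twisted N i j) (fun _ _ => Twisted.add) (Twisted.zero i j) hf

theorem Twisted.mul {N : ℕ} {i j k : Fin N} {f g : LaurentSeries ℝ}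
    (hf : Twisted N i k f) (hg : Twisted N k j g) : Twisted N i j (f * g) := by
  intro p hp
  simp only [lamCoeff, HahnSeries.coeff_mul]
  refine Finset.sum_eq_zero fun ab hab => ?_
  rw [Finset.mem_antidiagonal] at hab
  obtain ⟨ha, hb, hs⟩ := hab
  exfalso
  have h1 : (i : ℤ) - (k : ℤ) ≡ -ab.1 [ZMOD N] := by
    by_contra hc
    exact ha (by simpa [lamCoeff] using hf _ hc)
  have h2 : (k : ℤ) - (j : ℤ) ≡ -ab.2 [ZMOD N] := by
    by_contra hc
    exact hb (by simpa [lamCoeff] using hg _ hc)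
  apply hp
  have h3 := h1.add h2
  have e1 : (i : ℤ) - k + (k - j) = i - j := by ring
  have e2 : -ab.1 + -ab.2 = p := by omega
  rwa [e1, e2] at h3

theorem Twisted.const {N : ℕ} (i : Fin N) (r : ℝ) : Twisted N i i (HahnSeries.C r) := by
  intro p hp
  have hp0 : p ≠ 0 := by
    rintro rfl
    exact hp (by simp)
  simp [lamCoeff, HahnSeries.C_apply, HahnSeries.coeff_single_of_ne, hp0]

/-- The twisted loop algebra `g`: the `N × N` matrices `u(λ) = ∑ λ ^ p u_{ij}^{(p)} E_{ij}`, the sum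
being over `i - j ≡ p (mod N)` and over `p` bounded from above. -/
def loopSub (N : ℕ) : Subalgebra ℝ (Matrix (Fin N) (Fin N) (LaurentSeries ℝ)) where
  carrier := {u | ∀ i j, Twisted N i j (u i j)}
  mul_mem' := by
    intro u v hu hv i j
    rw [Matrix.mul_apply]
    exact Twisted.sum _ fun k _ => (hu i k).mul (hv k j)
  add_mem' := by
    intro u v hu hv i j
    exact (hu i j).add (hv i j)
  algebraMap_mem' := by
    intro r i j
    rw [Matrix.algebraMap_matrix_apply]
    split_ifs with h
    · subst h
      exact Twisted.const i r
    · exact Twisted.zero i j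

/-- The type of the elements of the twisted loop algebra. -/
def LoopAlg (N : ℕ) : Type := loopSub N

instance instRingLoopAlg (N : ℕ) : Ring (LoopAlg N) := inferInstanceAs (Ring (loopSub N))

instance instAlgebraLoopAlg (N : ℕ) : Algebra ℝ (LoopAlg N) :=
  inferInstanceAs (Algebra ℝ (loopSub N))

/-- The matrix of series underlying an element of the loop algebra. -/
def LoopAlg.mat {N : ℕ} (u : LoopAlg N) : Matrix (Fin N) (Fin N) (LaurentSeries ℝ) := u.1

theorem LoopAlg.ext_mat {N : ℕ} {u v : LoopAlg N} (h : u.mat = v.mat) : u = v := Subtype.ext h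

theorem LoopAlg.mat_add {N : ℕ} (u v : LoopAlg N) : (u + v).mat = u.mat + v.mat := rfl

theorem LoopAlg.mat_smul {N : ℕ} (r : ℝ) (u : LoopAlg N) : (r • u).mat = r • u.mat := rfl

theorem LoopAlg.mat_mul {N : ℕ} (u v : LoopAlg N) : (u * v).mat = u.mat * v.mat := rfl

/-- The coordinate function `u ↦ u_{ij}^{(p)}` on the loop algebra. -/
def coord {N : ℕ} (p : ℤ) (i j : Fin N) (u : LoopAlg N) : ℝ := lamCoeff p (u.mat i j)

/-- The scalar product `⟨u, v⟩ = tr(u v)_0`, the free term of the trace. -/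
def inner0 {N : ℕ} (u v : LoopAlg N) : ℝ := lamCoeff 0 (Matrix.trace (u * v).mat)

/-- Keep the terms `λ ^ p` of a series whose exponents satisfy `P`. -/
def keepSeries (P : ℤ → Prop) [DecidablePred P] : LaurentSeries ℝ →ₗ[ℝ] LaurentSeries ℝ where
  toFun f :=
    { coeff := fun n => if P (-n) then f.coeff n else 0
      isPWO_support' := f.isPWO_support.mono (by
        intro n hn
        simp only [Function.mem_support, ne_eq, ite_eq_right_iff, Classical.not_imp] at hn
        exact hn.2) }
  map_add' f g := by
    ext n
    by_cases h : P (-n) <;> simp [h]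
  map_smul' r f := by
    ext n
    by_cases h : P (-n) <;> simp [h]

/-- Projection of the loop algebra onto the span of its homogeneous components `g_p` with `P p`. -/
def keep {N : ℕ} (P : ℤ → Prop) [DecidablePred P] : LoopAlg N →ₗ[ℝ] LoopAlg N where
  toFun u := ⟨u.mat.map (keepSeries P), by
    intro i j p hp
    have h : (u.mat i j).coeff (-p) = 0 := u.2 i j p hp
    simp [lamCoeff, keepSeries, h]⟩
  map_add' u v := by
    apply LoopAlg.ext_mat
    ext1 i j
    change keepSeries P (u.mat i j + v.mat i j) = keepSeries P (u.mat i j) + keepSeries P (v.mat i j)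
    rw [map_add]
  map_smul' r u := by
    apply LoopAlg.ext_mat
    ext1 i j
    change keepSeries P (r • u.mat i j) = r • keepSeries P (u.mat i j)
    rw [map_smul]

/-- The projection onto positive powers of `λ`. -/
def Pplus {N : ℕ} : LoopAlg N →ₗ[ℝ] LoopAlg N := keep (fun p => 0 < p)

/-- The projection onto negative powers of `λ`. -/
def Pminus {N : ℕ} : LoopAlg N →ₗ[ℝ] LoopAlg N := keep (fun p => p < 0)

/-- The projection onto the free term (a diagonal matrix). -/
def Pzero {N : ℕ} : LoopAlg N →ₗ[ℝ] LoopAlg N := keep (fun p => p = 0)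

/-- `R₀ = P₊ - P₋`. -/
def R0 {N : ℕ} : LoopAlg N →ₗ[ℝ] LoopAlg N :=
  Pplus - Pminus

/-- The constants `π_{jk}`. -/
def piSign {N : ℕ} (j k : Fin N) : ℝ := if k < j then 1 else if j < k then -1 else 0

/-- The operator `Π`: it depends only on the free term, and `Π(E_{jj}) = ∑_k π_{jk} E_{kk}`. -/
def Pi0 {N : ℕ} : LoopAlg N →ₗ[ℝ] LoopAlg N where
  toFun u := ⟨Matrix.diagonal fun k => HahnSeries.C (∑ j, coord 0 j j u * piSign j k), by
    intro i j
    by_cases h : i = j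
    · subst h
      rw [Matrix.diagonal_apply_eq]
      exact Twisted.const i _
    · rw [Matrix.diagonal_apply_ne _ h]
      exact Twisted.zero i j⟩
  map_add' u v := by
    apply LoopAlg.ext_mat
    change Matrix.diagonal _ = Matrix.diagonal _ + Matrix.diagonal _
    rw [Matrix.diagonal_add]
    congr 1
    ext1 k
    simp only [coord, lamCoeff, LoopAlg.mat_add, Matrix.add_apply, HahnSeries.coeff_add, add_mul,
      Finset.sum_add_distrib, map_add]
  map_smul' r u := by
    apply LoopAlg.ext_mat
    change Matrix.diagonal _ = r • Matrix.diagonal _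
    rw [← Matrix.diagonal_smul]
    congr 1
    ext k n
    by_cases hn : n = 0 <;>
      simp [HahnSeries.C_apply, hn, coord, lamCoeff, LoopAlg.mat_smul, Finset.mul_sum, mul_assoc]

/-- `A = (R₀ + Π) / 2`. -/
def opA {N : ℕ} : LoopAlg N →ₗ[ℝ] LoopAlg N :=
  (1 / 2 : ℝ) • (R0 + Pi0)

/-- `B = (P₀ - Π) / 2`. -/
def opB {N : ℕ} : LoopAlg N →ₗ[ℝ] LoopAlg N :=
  (1 / 2 : ℝ) • (Pzero - Pi0)

/-- `C = (P₀ + Π) / 2`. -/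
def opC {N : ℕ} : LoopAlg N →ₗ[ℝ] LoopAlg N :=
  (1 / 2 : ℝ) • (Pzero + Pi0)

/-- `D = (R₀ - Π) / 2`. -/
def opD {N : ℕ} : LoopAlg N →ₗ[ℝ] LoopAlg N :=
  (1 / 2 : ℝ) • (R0 - Pi0)

/-- `R = (R₀ + P₀) / 2`, which equals both `A + B` and `C + D`. -/
def opR {N : ℕ} : LoopAlg N →ₗ[ℝ] LoopAlg N :=
  (1 / 2 : ℝ) • (R0 + Pzero)

/-! ### The quadratic bracket PB(A, B, C, D) -/

/-- `G` is a gradient of `φ` at `u`: `⟨G, X⟩ = d/dε φ(u + ε X)` at `ε = 0`, for all `X`. -/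
def HasGrad {N : ℕ} (φ : LoopAlg N → ℝ) (u G : LoopAlg N) : Prop :=
  ∀ X : LoopAlg N, HasDerivAt (fun ε : ℝ => φ (u + ε • X)) (inner0 G X) 0

/-- Smooth functions on the loop algebra: smooth on all finite-dimensional affine subspaces, with
gradients in the loop algebra. All smooth functions of finitely many coordinates are of this
kind. -/
def IsSmooth {N : ℕ} (φ : LoopAlg N → ℝ) : Prop :=
  (∀ (n : ℕ) (u : LoopAlg N) (X : Fin n → LoopAlg N),
    ContDiff ℝ ∞ fun t : Fin n → ℝ => φ (u + ∑ i, t i • X i)) ∧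
  ∀ u, ∃ G, HasGrad φ u G

open Classical in
/-- The gradient of a function (zero where there is none). It is unique because the scalar product
is nondegenerate. -/
def grad {N : ℕ} (φ : LoopAlg N → ℝ) (u : LoopAlg N) : LoopAlg N :=
  if h : ∃ G, HasGrad φ u G then h.choose else 0

/-- `dφ(u) = u · ∇φ(u)`. -/
def dL {N : ℕ} (φ : LoopAlg N → ℝ) (u : LoopAlg N) : LoopAlg N := u * grad φ u

/-- `d'φ(u) = ∇φ(u) · u`. -/
def dR {N : ℕ} (φ : LoopAlg N → ℝ) (u : LoopAlg N) : LoopAlg N := grad φ u * u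

/-- The bracket PB(A, B, C, D). -/
def PB {N : ℕ} (A B C D : LoopAlg N →ₗ[ℝ] LoopAlg N) (φ ψ : LoopAlg N → ℝ) (u : LoopAlg N) : ℝ :=
  inner0 (A (dR φ u)) (dR ψ u) - inner0 (D (dL φ u)) (dL ψ u)
    + inner0 (B (dL φ u)) (dR ψ u) - inner0 (C (dR φ u)) (dL ψ u)

/-- The Hamiltonian vector field `u ↦ {φ, u}` of `φ` for PB(A, B, C, D). -/
def hamField {N : ℕ} (A B C D : LoopAlg N →ₗ[ℝ] LoopAlg N) (φ : LoopAlg N → ℝ)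
    (u : LoopAlg N) : LoopAlg N :=
  u * A (dR φ u) - D (dL φ u) * u + u * B (dL φ u) - C (dR φ u) * u

/-! ### Poisson submanifolds given by a parametrization -/

/-- The curve `c` in the loop algebra has the derivative `D` at `t` (coordinatewise). -/
def HasCurveDeriv {N : ℕ} (c : ℝ → LoopAlg N) (D : LoopAlg N) (t : ℝ) : Prop :=
  ∀ p i j, HasDerivAt (fun s => coord p i j (c s)) (coord p i j D) t

/-- The bracket `{f, h}` on a space with coordinates `z_a` and `{z_a, z_b} = ϖ a b z`. -/
def coordBracket {ι : Type} [Fintype ι] [DecidableEq ι] (ϖ : ι → ι → (ι → ℝ) → ℝ)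
    (f h : (ι → ℝ) → ℝ) (z : ι → ℝ) : ℝ :=
  ∑ a, ∑ b, ϖ a b z * fderiv ℝ f z (Pi.single a 1) * fderiv ℝ h z (Pi.single b 1)

/-- The family `F z` is an immersion at `z`: a direction in which it has derivative zero is
zero. -/
def IsImmersedAt {N : ℕ} {ι : Type} (F : (ι → ℝ) → LoopAlg N) (z : ι → ℝ) : Prop :=
  ∀ w : ι → ℝ, HasCurveDeriv (fun ε => F (z + ε • w)) 0 0 → w = 0

/-- The elements `F z` form a Poisson submanifold of the loop algebra with the bracket
PB(A, B, C, D), the induced bracket in the coordinates `z` being `{z_a, z_b} = ϖ a b z`. -/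
structure IsPoissonSubmanifold {N : ℕ} {ι : Type} [Fintype ι] [DecidableEq ι]
    (A B C D : LoopAlg N →ₗ[ℝ] LoopAlg N) (ϖ : ι → ι → (ι → ℝ) → ℝ)
    (F : (ι → ℝ) → LoopAlg N) : Prop where
  /-- only finitely many powers of `λ` occur in the family -/
  bounded : ∃ K : ℤ, ∀ z p i j, K < |p| → coord p i j (F z) = 0
  /-- the parametrization is smooth -/
  smooth : ∀ p i j, ContDiff ℝ ∞ fun z => coord p i j (F z)
  /-- the parametrization is an immersion on a dense open set -/
  immersion : ∃ Ω : Set (ι → ℝ), IsOpen Ω ∧ Dense Ω ∧ ∀ z ∈ Ω, IsImmersedAt F z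
  /-- the parametrization is a Poisson map -/
  poisson : ∀ φ ψ : LoopAlg N → ℝ, IsSmooth φ → IsSmooth ψ → ∀ z,
    coordBracket ϖ (φ ∘ F) (ψ ∘ F) z = PB A B C D φ ψ (F z)
  /-- Hamiltonian vector fields are tangent to the family -/
  tangent : ∀ φ : LoopAlg N → ℝ, IsSmooth φ → ∀ z,
    HasCurveDeriv
      (fun ε : ℝ => F (z + ε • fun b => coordBracket ϖ (φ ∘ F) (fun y => y b) z))
      (hamField A B C D φ (F z)) 0

/-! ### The periodic Bogoyavlensky lattice with `M = m N` particles -/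

/-- The right-hand side of the lattice equations
`ż_k = z_k (∑_{j=1}^{m-1} z_{k+j} - ∑_{j=1}^{m-1} z_{k-j})`. -/
def latticeField (m N : ℕ) (z : ZMod (m * N) → ℝ) (k : ZMod (m * N)) : ℝ :=
  z k * (∑ j ∈ Finset.Icc 1 (m - 1), z (k + (j : ZMod (m * N)))
    - ∑ j ∈ Finset.Icc 1 (m - 1), z (k - (j : ZMod (m * N))))

/-- The curve `z` satisfies the lattice equations at the time `t`. -/
def SolvesAt (m N : ℕ) (z : ℝ → ZMod (m * N) → ℝ) (t : ℝ) : Prop :=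
  ∀ k, HasDerivAt (fun s => z s k) (latticeField m N (z t) k) t

/-- The brackets `{z_j, z_k}`: `z_j z_k` if `j - k ≡ 1, …, m - 1`, `-z_j z_k` if
`j - k ≡ -1, …, -(m - 1)` modulo `m N`, and zero otherwise. (The two cases exclude each other if
`N ≥ 2`; for `N = 1` the contributions cancel.) -/
def latticeBracket (m N : ℕ) (j k : ZMod (m * N)) (z : ZMod (m * N) → ℝ) : ℝ :=
  (∑ i ∈ Finset.Icc 1 (m - 1),
    ((if j = k + (i : ZMod (m * N)) then 1 else 0)
      - (if k = j + (i : ZMod (m * N)) then 1 else 0))) * z j * z k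

section matrices

variable {R : Type*} [CommRing R]

/-- The `j`-th sort of particles, `v_k^{(j)} = z_{m (k - 1) + j}` for `k = 1, …, N`. The index
`k : Fin N` starts from zero, so it stands for `k + 1`. -/
def vsort (m N : ℕ) (z : ZMod (m * N) → R) (j : ℕ) (k : Fin N) : R :=
  z ((m * (k : ℕ) + j : ℕ) : ZMod (m * N))

/-- `U₁ = λ ∑ E_{k+1,k} + ∑ v_k^{(1)} E_{kk}` with `k` modulo `N`. -/
def matU (m N : ℕ) [NeZero N] (l : Rˣ) (z : ZMod (m * N) → R) : Matrix (Fin N) (Fin N) R :=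
  (l : R) • ∑ k : Fin N, Matrix.single (k + 1) k (1 : R)
    + ∑ k : Fin N, Matrix.single k k (vsort m N z 1 k)

/-- `V_j = I + λ⁻¹ ∑ v_k^{(j)} E_{k,k+1}` with `k` modulo `N`. -/
def matV (m N : ℕ) [NeZero N] (l : Rˣ) (z : ZMod (m * N) → R) (j : ℕ) :
    Matrix (Fin N) (Fin N) R :=
  1 + ((l⁻¹ : Rˣ) : R) • ∑ k : Fin N, Matrix.single k (k + 1) (vsort m N z j k)

/-- `L_j = V_j ⋯ V_2 U_1 V_m ⋯ V_{j+1}` for `1 ≤ j ≤ m`. -/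
def matL (m N : ℕ) [NeZero N] (l : Rˣ) (z : ZMod (m * N) → R) (j : ℕ) :
    Matrix (Fin N) (Fin N) R :=
  ((List.range' 2 (j - 1)).reverse.map (matV m N l z)).prod
    * matU m N l z
    * ((List.range' (j + 1) (m - j)).reverse.map (matV m N l z)).prod

/-- `T = λ^{-m+1} ∑ z_k E_{k,k+m-1} + λ ∑ E_{k+1,k}` with `k` modulo `m N`. -/
def matT (m N : ℕ) [NeZero m] [NeZero N] (l : Rˣ) (z : ZMod (m * N) → R) :
    Matrix (ZMod (m * N)) (ZMod (m * N)) R :=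
  (((l⁻¹) ^ (m - 1) : Rˣ) : R) •
      ∑ k : ZMod (m * N), Matrix.single k (k + (m : ZMod (m * N)) - 1) (z k)
    + (l : R) • ∑ k : ZMod (m * N), Matrix.single (k + 1) k (1 : R)

end matrices

/-! ### The matrices as elements of the loop algebra -/

/-- Real numbers as constant series. -/
def constSeries {ι : Type} (z : ι → ℝ) (a : ι) : LaurentSeries ℝ := HahnSeries.C (z a)

theorem twisted_single {N : ℕ} {i j : Fin N} {q : ℤ} (r : ℝ)
    (h : (i : ℤ) - (j : ℤ) ≡ q [ZMOD N]) : Twisted N i j (HahnSeries.single (-q) r) := by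
  intro p hp
  have hne : p ≠ q := by
    rintro rfl
    exact hp h
  simp [lamCoeff, HahnSeries.coeff_single_of_ne, hne]

theorem succ_sub_modEq {N : ℕ} [NeZero N] (k : Fin N) :
    ((k + 1 : Fin N) : ℤ) - (k : ℤ) ≡ 1 [ZMOD N] := by
  have h : ((k + 1 : Fin N) : ℕ) ≡ (k : ℕ) + 1 [MOD N] := by
    rw [Fin.val_add]
    refine (Nat.mod_modEq _ _).trans (Nat.ModEq.add_left _ ?_)
    rw [Fin.val_one']
    exact Nat.mod_modEq _ _
  have h' : ((k + 1 : Fin N) : ℤ) ≡ (k : ℤ) + 1 [ZMOD N] := by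
    exact_mod_cast (Int.natCast_modEq_iff.mpr h)
  simpa using h'.sub_right (k : ℤ)

theorem sub_succ_modEq {N : ℕ} [NeZero N] (k : Fin N) :
    (k : ℤ) - ((k + 1 : Fin N) : ℤ) ≡ -1 [ZMOD N] := by
  simpa using (succ_sub_modEq k).neg

theorem single_mem {N : ℕ} {i j : Fin N} {f : LaurentSeries ℝ} (h : Twisted N i j f) :
    Matrix.single i j f ∈ loopSub N := by
  intro a b
  rw [Matrix.single_apply]
  split_ifs with hab
  · obtain ⟨rfl, rfl⟩ := hab
    exact h
  · exact Twisted.zero a b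

theorem matU_mem (m N : ℕ) [NeZero N] (z : ZMod (m * N) → ℝ) :
    matU m N lam (constSeries z) ∈ loopSub N := by
  refine Subalgebra.add_mem _ ?_ (Subalgebra.sum_mem _ fun k _ => single_mem (Twisted.const k _))
  rw [Finset.smul_sum]
  refine Subalgebra.sum_mem _ fun k _ => ?_
  rw [Matrix.smul_single]
  apply single_mem
  simpa [lam] using twisted_single 1 (succ_sub_modEq k)

theorem matV_mem (m N : ℕ) [NeZero N] (z : ZMod (m * N) → ℝ) (j : ℕ) :
    matV m N lam (constSeries z) j ∈ loopSub N := by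
  refine Subalgebra.add_mem _ (Subalgebra.one_mem _) ?_
  rw [Finset.smul_sum]
  refine Subalgebra.sum_mem _ fun k _ => ?_
  rw [Matrix.smul_single]
  apply single_mem
  have h := twisted_single (vsort m N z j k) (sub_succ_modEq k)
  have e : ((lam⁻¹ : (LaurentSeries ℝ)ˣ) : LaurentSeries ℝ) • vsort m N (constSeries z) j k
      = HahnSeries.single (-(-1)) (vsort m N z j k) := by
    change (HahnSeries.single (1 : ℤ) (1 : ℝ)) * HahnSeries.single (0 : ℤ) _ = _
    rw [HahnSeries.single_mul_single]
    simp [vsort]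
  rw [e]
  exact h

theorem matL_mem (m N : ℕ) [NeZero N] (z : ZMod (m * N) → ℝ) (j : ℕ) :
    matL m N lam (constSeries z) j ∈ loopSub N := by
  refine Subalgebra.mul_mem _ (Subalgebra.mul_mem _ ?_ (matU_mem m N z)) ?_ <;>
  · refine Subalgebra.list_prod_mem _ fun x hx => ?_
    obtain ⟨i, _, rfl⟩ := List.mem_map.mp hx
    exact matV_mem m N z i

/-- `U₁(λ)` as an element of the loop algebra. -/
def loopU (m N : ℕ) [NeZero N] (z : ZMod (m * N) → ℝ) : LoopAlg N :=
  ⟨matU m N lam (constSeries z), matU_mem m N z⟩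

/-- `V_j(λ)` as an element of the loop algebra. -/
def loopV (m N : ℕ) [NeZero N] (j : ℕ) (z : ZMod (m * N) → ℝ) : LoopAlg N :=
  ⟨matV m N lam (constSeries z) j, matV_mem m N z j⟩

/-- `L_j(λ)` as an element of the loop algebra. -/
def loopL (m N : ℕ) [NeZero N] (j : ℕ) (z : ZMod (m * N) → ℝ) : LoopAlg N :=
  ⟨matL m N lam (constSeries z) j, matL_mem m N z j⟩

/-- The `j`-th factor of the cyclic product: `U₁` for `j = 1` and `V_j` for `j ≥ 2`. -/
def loopW (m N : ℕ) [NeZero N] (j : ℕ) (z : ZMod (m * N) → ℝ) : LoopAlg N :=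
  if j = 1 then loopU m N z else loopV m N j z

/-- The cyclic predecessor of `j` in `1, …, m`. -/
def cycPred (m j : ℕ) : ℕ := if j = 1 then m else j - 1

/-- The Lax equation `L̇_j = [L_j, R(L_j)]` along the curve `z` at the time `t`. -/
def LaxAt (m N : ℕ) [NeZero N] (j : ℕ) (z : ℝ → ZMod (m * N) → ℝ) (t : ℝ) : Prop :=
  HasCurveDeriv (fun s => loopL m N j (z s))
    (loopL m N j (z t) * opR (loopL m N j (z t)) - opR (loopL m N j (z t)) * loopL m N j (z t)) t

end Bogoyavlensky

end

noncomputable section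

namespace Bogoyavlensky

/-! ### The cyclic factorization over a commutative ring -/

section factors

variable {R : Type*} [CommRing R] {N : ℕ} [NeZero N]

/-! For a residue `a` modulo `mN` let `Q_a = I + λ⁻¹ ∑ z_{mk+a} E_{k,k+1}`, and let `S` be the
shift. Then `S Q_a = Q_{a-m} S`, so pushing the shift of `U₁` to the right gives `L_j = Q_j Q_{j-1}
⋯ Q_{j-m+1} S` (`matL_eq`). This makes sense for every index `n` modulo `mN` and treats all factors
alike. Moving `Q_n` from the left end to the right end turns `L_n` into `L_{n-1}`
(`exists_loopMat_factor`); this yields the gauge relations and the equality of the characteristic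
polynomials. The matrix `T` sends the residue class of `n` modulo `m` to that of `n+1` by `λ
Q_{n+1}(λ^m)`, so `T^m` is block diagonal with blocks `L_n(λ^m)` (`matT_pow_mul_classMat_self`).

For the Poisson property let `G` be the gradient at `L`, put `X = GL` and `Y = LG`, and carry `X`
through the factors, `X_0 = S X S⁻¹` and `X_{i+1} = Q X_i Q⁻¹` for the successive factors `Q`, which
ends at `Y`. The Hamiltonian field is `L(AX + BY) - (DY + CX)L`. The two brackets are `R(X)` and
`R(Y)` up to constant diagonal matrices, and these correspond under the shift because `X` and `Y`
have equal traces (`piSign_succ`). Since `R` multiplies all degrees `p ≥ 0` by `1/2` and all others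
by `-1/2`, the difference `Q R(X_i) - R(X_{i+1}) Q` lives in degree `-1` alone (`opR_step`) and is
therefore a variation of `Q`. Hence the field is tangent to the family (`dchain_hamiltonian`). The
free terms of successive `X_i` differ by differences of `z_a ∂_a φ` (`conj_free_succ`); summing them
identifies the variation with the Hamiltonian field of the lattice (`sum_neighbours`,
`dloopChain_latticeHam`). Tangency gives the Poisson property, since the bracket is `⟨∇ψ, X_φ⟩`
(`inner0_hamField`).

The gradient `G = I` belongs to `tr(u)_0`, which is `∑ z_k` on the family; its field is the lattice,
and the formula becomes `[L, R(L)]` (`dloopChain_latticeField`). Conversely a Lax equation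
determines the velocity wherever the family is an immersion. By analyticity injectivity of the
derivative at one point suffices (`exists_dense_open_injective`), and it is checked where the
factors are distinct constants (`eq_zero_of_dchain_eq_zero`). The determinants are conserved by
Jacobi's formula. -/

/-- The shift `λ ∑ E_{k+1,k}`. -/
def shiftMat (N : ℕ) [NeZero N] (l : Rˣ) : Matrix (Fin N) (Fin N) R :=
  (l : R) • ∑ k : Fin N, Matrix.single (k + 1) k (1 : R)

/-- The matrix `λ⁻¹ ∑ v_k E_{k,k+1}`. -/
def lowMat (l : Rˣ) (v : Fin N → R) : Matrix (Fin N) (Fin N) R :=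
  ((l⁻¹ : Rˣ) : R) • ∑ k : Fin N, Matrix.single k (k + 1) (v k)

/-- The elementary factor `I + λ⁻¹ ∑ v_k E_{k,k+1}`. -/
def stepMat (l : Rˣ) (v : Fin N → R) : Matrix (Fin N) (Fin N) R := 1 + lowMat l v

theorem shiftMat_apply (l : Rˣ) (i j : Fin N) :
    shiftMat N l i j = if j = i - 1 then (l : R) else 0 := by
  rw [shiftMat, Matrix.smul_apply, Matrix.sum_apply, Finset.sum_eq_single j]
  · simp only [Matrix.single_apply, and_true, smul_eq_mul, mul_ite, mul_one, mul_zero]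
    congr 1
    rw [eq_iff_iff]
    exact ⟨fun h => by rw [← h, add_sub_cancel_right], fun h => by rw [h, sub_add_cancel]⟩
  · intro k _ hk
    simp [hk]
  · simp

theorem lowMat_apply (l : Rˣ) (v : Fin N → R) (i j : Fin N) :
    lowMat l v i j = if j = i + 1 then ((l⁻¹ : Rˣ) : R) * v i else 0 := by
  rw [lowMat, Matrix.smul_apply, Matrix.sum_apply, Finset.sum_eq_single i]
  · simp [Matrix.single_apply, eq_comm]
  · intro k _ hk
    simp [hk]
  · simp

theorem shiftMat_mul_apply (l : Rˣ) (u : Matrix (Fin N) (Fin N) R) (i j : Fin N) :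
    (shiftMat N l * u) i j = l * u (i - 1) j := by
  simp [Matrix.mul_apply, shiftMat_apply]

theorem mul_shiftMat_apply (l : Rˣ) (u : Matrix (Fin N) (Fin N) R) (i j : Fin N) :
    (u * shiftMat N l) i j = l * u i (j + 1) := by
  rw [Matrix.mul_apply, Finset.sum_eq_single (j + 1)]
  · simp [shiftMat_apply, mul_comm]
  · intro k _ hk
    rw [shiftMat_apply, if_neg, mul_zero]
    rintro rfl
    simp at hk
  · simp

theorem lowMat_mul_apply (l : Rˣ) (v : Fin N → R) (u : Matrix (Fin N) (Fin N) R) (i j : Fin N) :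
    (lowMat l v * u) i j = ((l⁻¹ : Rˣ) : R) * (v i * u (i + 1) j) := by
  simp [Matrix.mul_apply, lowMat_apply, mul_assoc]

theorem mul_lowMat_apply (l : Rˣ) (v : Fin N → R) (u : Matrix (Fin N) (Fin N) R) (i j : Fin N) :
    (u * lowMat l v) i j = ((l⁻¹ : Rˣ) : R) * (u i (j - 1) * v (j - 1)) := by
  rw [Matrix.mul_apply, Finset.sum_eq_single (j - 1)]
  · simp [lowMat_apply]
    ring
  · intro k _ hk
    rw [lowMat_apply, if_neg, mul_zero]
    rintro rfl
    simp at hk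
  · simp

theorem shiftMat_mul_stepMat (l : Rˣ) (v w : Fin N → R) (h : ∀ k, w (k + 1) = v k) :
    shiftMat N l * stepMat l v = stepMat l w * shiftMat N l := by
  rw [stepMat, stepMat, mul_add, add_mul, mul_one, one_mul]
  congr 1
  ext i j
  rw [shiftMat_mul_apply, mul_shiftMat_apply, lowMat_apply, lowMat_apply, ← h (i - 1)]
  simp only [sub_add_cancel, add_left_inj]

/-- The product `V_{n-1} ⋯ V_1 V_0` of elementary factors. -/
def stepProd (l : Rˣ) (V : ℕ → Fin N → R) : ℕ → Matrix (Fin N) (Fin N) R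
  | 0 => 1
  | n + 1 => stepMat l (V n) * stepProd l V n

theorem stepProd_add (l : Rˣ) (V : ℕ → Fin N → R) (a b : ℕ) :
    stepProd l V (a + b) = stepProd l (fun i => V (a + i)) b * stepProd l V a := by
  induction b with
  | zero => simp [stepProd]
  | succ b ih => rw [← add_assoc, stepProd, ih, stepProd, mul_assoc]

theorem stepProd_of_eq_add (l : Rˣ) (V : ℕ → Fin N → R) {n a b : ℕ} (h : n = a + b) :
    stepProd l V n = stepProd l (fun i => V (a + i)) b * stepProd l V a := by
  rw [h, stepProd_add]

theorem stepProd_one (l : Rˣ) (V : ℕ → Fin N → R) : stepProd l V 1 = stepMat l (V 0) := by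
  simp [stepProd]

theorem shiftMat_mul_stepProd (l : Rˣ) (V W : ℕ → Fin N → R) (h : ∀ i k, W i (k + 1) = V i k)
    (n : ℕ) : shiftMat N l * stepProd l V n = stepProd l W n * shiftMat N l := by
  induction n with
  | zero => simp [stepProd]
  | succ n ih =>
    rw [stepProd, stepProd, ← mul_assoc, shiftMat_mul_stepMat l _ _ (h n), mul_assoc, ih, mul_assoc]

end factors

/-! ### Particles with a given index modulo the block length -/

section slots

variable {R : Type*} {m N : ℕ}

/-- The particles `z_{m k + a}`, `k = 0, …, N - 1`. -/
def slot (m N : ℕ) (z : ZMod (m * N) → R) (a : ZMod (m * N)) (k : Fin N) : R :=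
  z ((m : ZMod (m * N)) * ((k : ℕ) : ZMod (m * N)) + a)

theorem cast_fin_succ [NeZero N] (k : Fin N) :
    (m : ZMod (m * N)) * (((k + 1 : Fin N) : ℕ) : ZMod (m * N))
      = (m : ZMod (m * N)) * ((k : ℕ) : ZMod (m * N)) + m := by
  have h : ((k + 1 : Fin N) : ℕ) ≡ (k : ℕ) + 1 [MOD N] := by
    rw [Fin.val_add]
    refine (Nat.mod_modEq _ _).trans (Nat.ModEq.add_left _ ?_)
    rw [Fin.val_one']
    exact Nat.mod_modEq _ _
  have h2 := (ZMod.natCast_eq_natCast_iff _ _ _).mpr (h.mul_left' m)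
  push_cast at h2
  rw [h2]
  ring

/-- Going to the next block adds `m` to the index, also across the end of the period, because
indices live modulo `mN`. This is what turns commutation with the shift into `S Q_a = Q_{a-m} S`. -/
theorem slot_succ [NeZero N] (z : ZMod (m * N) → R) (a : ZMod (m * N)) (k : Fin N) :
    slot m N z a (k + 1) = slot m N z (a + m) k := by
  rw [slot, slot, cast_fin_succ]
  congr 1
  ring

theorem vsort_eq_slot (z : ZMod (m * N) → R) (j : ℕ) : vsort m N z j = slot m N z j := by
  ext k
  simp [vsort, slot]

end slots

/-! ### The loop matrices for all residues modulo `mN` -/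

section cyclic

variable {R : Type*} [CommRing R] {m N : ℕ} [NeZero N]

/-- The slots of the consecutive factors of the `n`-th loop matrix. -/
def slots (m N : ℕ) (z : ZMod (m * N) → R) (n : ZMod (m * N)) (i : ℕ) : Fin N → R :=
  slot m N z (n - m + 1 + i)

/-- The matrix `Q_n Q_{n-1} ⋯ Q_{n-m+1} S`, where `Q_a` is the elementary factor with the particles
`z_{m k + a}` and `S` is the shift. -/
def loopMat (m N : ℕ) [NeZero N] (l : Rˣ) (z : ZMod (m * N) → R) (n : ZMod (m * N)) :
    Matrix (Fin N) (Fin N) R :=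
  stepProd l (slots m N z n) m * shiftMat N l

theorem reverse_range'_prod {M : Type*} [Monoid M] (f : ℕ → M) (a n : ℕ) :
    ((List.range' a (n + 1)).reverse.map f).prod
      = f (a + n) * ((List.range' a n).reverse.map f).prod := by
  rw [List.range'_concat]
  simp

theorem matV_eq (l : Rˣ) (z : ZMod (m * N) → R) (j : ℕ) :
    matV m N l z j = stepMat l (slot m N z j) := by
  rw [← vsort_eq_slot]
  rfl

theorem prod_matV (l : Rˣ) (z : ZMod (m * N) → R) (a n : ℕ) :
    ((List.range' a n).reverse.map (matV m N l z)).prod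
      = stepProd l (fun i => slot m N z (a + i)) n := by
  induction n with
  | zero => simp [stepProd]
  | succ n ih => rw [reverse_range'_prod, ih, stepProd, matV_eq, Nat.cast_add]

theorem matU_eq (l : Rˣ) (z : ZMod (m * N) → R) :
    matU m N l z = stepMat l (slot m N z 1) * shiftMat N l := by
  rw [stepMat, add_mul, one_mul, matU]
  congr 1
  ext i j
  rw [lowMat_mul_apply, shiftMat_apply, Matrix.sum_apply, Finset.sum_eq_single i]
  · rw [vsort_eq_slot, Nat.cast_one]
    by_cases h : i = j
    · simp only [h, Matrix.single_apply_same]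
      rw [mul_left_comm, if_pos (by simp), Units.inv_mul, mul_one]
    · simp [h, Ne.symm h]
  · intro k _ hk
    simp [hk]
  · simp

/-- The shift contained in `U₁` is pushed to the right end; the factors `V_m, …, V_{j+1}` it passes
become `Q_0, …, Q_{j-m+1}` and continue the descending product `Q_j ⋯ Q_1`. -/
theorem matL_eq (l : Rˣ) (z : ZMod (m * N) → R) {j : ℕ} (hj : j ∈ Finset.Icc 1 m) :
    matL m N l z j = loopMat m N l z j := by
  obtain ⟨h1, h2⟩ := Finset.mem_Icc.mp hj
  rw [matL, prod_matV, prod_matV, matU_eq, loopMat, mul_assoc, mul_assoc,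
    shiftMat_mul_stepProd l _ (slots m N z j)]
  -- From the right: the `m - j` factors that the shift has passed, the factor of `U₁`, and the
  -- factors `V_2, …, V_j`.
  · have e : m = (m - j) + (1 + (j - 1)) := by omega
    rw [stepProd_of_eq_add _ _ e, stepProd_add, stepProd_one, mul_assoc, mul_assoc]
    have hm : ((m - j : ℕ) : ZMod (m * N)) = m - j := by rw [Nat.cast_sub h2]
    congr 2
    · funext i
      rw [slots]
      congr 1
      push_cast [hm]
      ring
    · rw [slots]
      congr 2
      push_cast [hm]
      ring
  · intro i k
    rw [slots, slot_succ]
    congr 1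
    push_cast
    ring

theorem shiftMat_mul_loopMat (l : Rˣ) (z : ZMod (m * N) → R) (n : ZMod (m * N)) :
    shiftMat N l * loopMat m N l z n = loopMat m N l z (n - m) * shiftMat N l := by
  rw [loopMat, ← mul_assoc, shiftMat_mul_stepProd l _ (slots m N z (n - m)), loopMat]
  intro i k
  rw [slots, slots, slot_succ]
  congr 1
  ring

/-- Here `Y = Q_{n-1} ⋯ Q_{n-m+1} S`. In `Y Q_n` the factor passes the shift and becomes `Q_{n-m}`,
the last factor of the loop matrix with index `n - 1`. -/
theorem exists_loopMat_factor [NeZero m] (l : Rˣ) (z : ZMod (m * N) → R) (n : ZMod (m * N)) :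
    ∃ Y, loopMat m N l z n = stepMat l (slot m N z n) * Y ∧
      loopMat m N l z (n - 1) = Y * stepMat l (slot m N z n) := by
  have hm : m = (m - 1) + 1 := (Nat.succ_pred_eq_of_ne_zero (NeZero.ne m)).symm
  have hc : ((m - 1 : ℕ) : ZMod (m * N)) = m - 1 := by
    rw [Nat.cast_sub (NeZero.one_le), Nat.cast_one]
  refine ⟨stepProd l (slots m N z n) (m - 1) * shiftMat N l, ?_, ?_⟩
  · rw [loopMat, stepProd_of_eq_add _ _ hm, stepProd_one, slots, mul_assoc, add_zero, hc]
    congr 3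
    ring
  · rw [loopMat, stepProd_of_eq_add _ _ (hm.trans (add_comm _ _)), stepProd_one, mul_assoc,
      mul_assoc, shiftMat_mul_stepMat l _ (slots m N z (n - 1) 0)]
    · congr 2
      funext i
      rw [slots, slots]
      congr 1
      push_cast
      ring
    · intro k
      rw [slots, slot_succ]
      congr 1
      push_cast
      ring

theorem loopMat_mul_stepMat [NeZero m] (l : Rˣ) (z : ZMod (m * N) → R) (n : ZMod (m * N)) :
    loopMat m N l z n * stepMat l (slot m N z n)
      = stepMat l (slot m N z n) * loopMat m N l z (n - 1) := by
  obtain ⟨Y, h1, h2⟩ := exists_loopMat_factor l z n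
  rw [h1, h2, mul_assoc]

/-- Passing through characteristic polynomials avoids inverting a factor, which need not be possible
over an arbitrary ring. -/
theorem det_mul_sub_comm {n : ℕ} (A B : Matrix (Fin n) (Fin n) R) (μ : R) :
    (A * B - μ • 1).det = (B * A - μ • 1).det := by
  have h (C : Matrix (Fin n) (Fin n) R) : (C - μ • 1).det = (-1) ^ n * C.charpoly.eval μ := by
    rw [Matrix.eval_charpoly, ← neg_sub, Matrix.det_neg, Fintype.card_fin,
      Matrix.smul_one_eq_diagonal]
    rfl
  rw [h, h, Matrix.charpoly_mul_comm]

theorem det_loopMat_sub_one [NeZero m] (l : Rˣ) (z : ZMod (m * N) → R) (n : ZMod (m * N)) (μ : R) :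
    (loopMat m N l z n - μ • 1).det = (loopMat m N l z (n - 1) - μ • 1).det := by
  obtain ⟨Y, h1, h2⟩ := exists_loopMat_factor l z n
  rw [h1, h2, det_mul_sub_comm]

theorem det_loopMat_eq [NeZero m] (l : Rˣ) (z : ZMod (m * N) → R) (j : ℕ) (μ : R) :
    (loopMat m N l z j - μ • 1).det = (loopMat m N l z 0 - μ • 1).det := by
  induction j with
  | zero => simp
  | succ j ih =>
    rw [det_loopMat_sub_one, ← ih]
    push_cast
    rw [add_sub_cancel_right]

/-! ### The big Lax matrix -/

/-- The embedding of the residue class of `n` modulo `m`: `e_k ↦ e_{m k + n}`. -/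
def classMat (R : Type*) [CommRing R] (m N : ℕ) (n : ZMod (m * N)) :
    Matrix (ZMod (m * N)) (Fin N) R :=
  Matrix.of fun a k => if a = (m : ZMod (m * N)) * ((k : ℕ) : ZMod (m * N)) + n then 1 else 0

theorem mul_classMat_apply [NeZero m] {ι : Type*} (A : Matrix ι (ZMod (m * N)) R)
    (n : ZMod (m * N)) (i : ι) (k : Fin N) :
    (A * classMat R m N n) i k = A i ((m : ZMod (m * N)) * ((k : ℕ) : ZMod (m * N)) + n) := by
  simp [Matrix.mul_apply, classMat]

theorem matT_apply [NeZero m] (l : Rˣ) (z : ZMod (m * N) → R) (a b : ZMod (m * N)) :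
    matT m N l z a b = (((l⁻¹) ^ (m - 1) : Rˣ) : R) * (if a + m - 1 = b then z a else 0)
      + (l : R) * (if a = b + 1 then 1 else 0) := by
  rw [matT, Matrix.add_apply, Matrix.smul_apply, Matrix.smul_apply, Matrix.sum_apply,
    Matrix.sum_apply, Finset.sum_eq_single a, Finset.sum_eq_single b]
  · simp [Matrix.single_apply, eq_comm]
  · intro k _ hk
    simp [hk]
  · simp
  · intro k _ hk
    simp [hk]
  · simp

theorem classMat_mul_stepMat [NeZero m] (l : Rˣ) (v : Fin N → R) (n a : ZMod (m * N)) (k : Fin N) :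
    (classMat R m N n * stepMat l v) a k = classMat R m N n a k
      + ((l⁻¹ : Rˣ) : R) * (classMat R m N n a (k - 1) * v (k - 1)) := by
  rw [stepMat, Matrix.mul_add, Matrix.mul_one, Matrix.add_apply]
  congr 1
  rw [Matrix.mul_apply, Finset.sum_eq_single (k - 1)]
  · simp [lowMat_apply]
    ring
  · intro j _ hj
    rw [lowMat_apply, if_neg, mul_zero]
    rintro rfl
    simp at hj
  · simp

/-- Both terms of `T` change the residue modulo `m` by `+1`: one raises the index by `1`, the other
lowers it by `m - 1`, which is `+1` in the preceding block. The ratio of their coefficients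
`λ^{-m+1}` and `λ` is `(λ^m)⁻¹`, which is why the small matrices carry the parameter `λ^m`. -/
theorem matT_mul_classMat [NeZero m] (l : Rˣ) (z : ZMod (m * N) → R) (n : ZMod (m * N)) :
    matT m N l z * classMat R m N n
      = (l : R) • (classMat R m N (n + 1) * stepMat (l ^ m) (slot m N z (n + 1))) := by
  ext a k
  rw [mul_classMat_apply, Matrix.smul_apply, classMat_mul_stepMat, matT_apply, smul_eq_mul, mul_add,
    add_comm]
  congr 1
  · simp only [classMat, Matrix.of_apply, add_assoc]
  · have hk : (m : ZMod (m * N)) * ((k : ℕ) : ZMod (m * N))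
        = (m : ZMod (m * N)) * (((k - 1 : Fin N) : ℕ) : ZMod (m * N)) + m := by
      rw [← cast_fin_succ, sub_add_cancel]
    have hl : (l : R) * ((((l ^ m)⁻¹ : Rˣ)) : R) = (((l⁻¹) ^ (m - 1) : Rˣ) : R) := by
      rw [← Units.val_mul]
      congr 1
      obtain ⟨q, hq⟩ : ∃ q, m = q + 1 := ⟨m - 1, (Nat.succ_pred_eq_of_ne_zero (NeZero.ne m)).symm⟩
      rw [hq, pow_succ, add_tsub_cancel_right, inv_pow]
      group
    rw [← mul_assoc, hl]
    congr 1
    simp only [classMat, Matrix.of_apply, slot]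
    by_cases h : a = (m : ZMod (m * N)) * (((k - 1 : Fin N) : ℕ) : ZMod (m * N)) + (n + 1)
    · rw [if_pos h, if_pos, one_mul, h]
      rw [h, hk]
      ring
    · rw [if_neg h, if_neg, zero_mul]
      intro h'
      apply h
      rw [hk] at h'
      linear_combination h'

theorem matT_pow_mul_classMat [NeZero m] (l : Rˣ) (z : ZMod (m * N) → R) (n : ZMod (m * N))
    (q : ℕ) : matT m N l z ^ q * classMat R m N n
      = ((l ^ q : Rˣ) : R) • (classMat R m N (n + q)
        * stepProd (l ^ m) (fun i => slot m N z (n + 1 + i)) q) := by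
  induction q with
  | zero => simp [stepProd]
  | succ q ih =>
    rw [pow_succ', Matrix.mul_assoc, ih, Matrix.mul_smul, ← Matrix.mul_assoc, matT_mul_classMat,
      Matrix.smul_mul, smul_smul, stepProd, Matrix.mul_assoc]
    push_cast
    rw [pow_succ, ← add_assoc]
    congr 5
    ring

theorem classMat_sub [NeZero m] (l : Rˣ) (n : ZMod (m * N)) :
    classMat R m N (n - m) * shiftMat N l = (l : R) • classMat R m N n := by
  ext a k
  rw [Matrix.mul_apply, Finset.sum_eq_single (k + 1)]
  · simp only [shiftMat_apply, add_sub_cancel_right, if_true, classMat, Matrix.of_apply,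
      cast_fin_succ, Matrix.smul_apply, smul_eq_mul]
    rw [mul_comm]
    congr 3
    ring_nf
  · intro j _ hj
    rw [shiftMat_apply, if_neg, mul_zero]
    rintro rfl
    simp at hj
  · simp

theorem matT_pow_mul_classMat_self [NeZero m] (l : Rˣ) (z : ZMod (m * N) → R) (n : ZMod (m * N)) :
    matT m N l z ^ m * classMat R m N n = classMat R m N n * loopMat m N (l ^ m) z n := by
  -- Starting from `n - m` makes the `m` steps end at `n`. Multiplication by the shift turns the
  -- embedding for `n - m` into that for `n`, at the cost of a factor `λ^m` on both sides, which
  -- cancels.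
  have h := congrArg (· * shiftMat N (l ^ m)) (matT_pow_mul_classMat l z (n - m) m)
  simp only [Matrix.mul_assoc, Matrix.smul_mul, classMat_sub, Matrix.mul_smul, sub_add_cancel] at h
  have h2 := congrArg ((((l ^ m)⁻¹ : Rˣ) : R) • ·) h
  simp only [smul_smul, Units.inv_mul, one_smul] at h2
  exact h2

/-- The numbering of the particles by sorts, starting from `c`. -/
def particleEquiv (m N : ℕ) [NeZero m] [NeZero N] (c : ZMod (m * N)) :
    Fin N × Fin m ≃ ZMod (m * N) :=
  Equiv.ofBijective
    (fun x => (m : ZMod (m * N)) * ((x.1 : ℕ) : ZMod (m * N)) + (c + ((x.2 : ℕ) : ZMod (m * N)))) <| by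
    rw [Fintype.bijective_iff_surjective_and_card]
    refine ⟨fun a => ?_, by simp [mul_comm]⟩
    refine ⟨(⟨(a - c).val / m, Nat.div_lt_of_lt_mul (ZMod.val_lt _)⟩,
      ⟨(a - c).val % m, Nat.mod_lt _ (NeZero.pos m)⟩), ?_⟩
    have h : ((m * ((a - c).val / m) + (a - c).val % m : ℕ) : ZMod (m * N)) = a - c := by
      rw [Nat.div_add_mod, ZMod.natCast_zmod_val]
    push_cast at h
    linear_combination h

theorem particleEquiv_apply [NeZero m] (c : ZMod (m * N)) (k : Fin N) (i : Fin m) :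
    particleEquiv m N c (k, i)
      = (m : ZMod (m * N)) * ((k : ℕ) : ZMod (m * N)) + (c + ((i : ℕ) : ZMod (m * N))) := rfl

/-- Numbering the particles by residue class modulo `m` makes `T^m` block diagonal, since it
preserves each class. -/
theorem det_matT_pow [NeZero m] (l : Rˣ) (z : ZMod (m * N) → R) (μ : R) :
    (matT m N l z ^ m - μ • 1).det
      = ∏ i : Fin m, (loopMat m N (l ^ m) z (1 + ((i : ℕ) : ZMod (m * N))) - μ • 1).det := by
  rw [← Matrix.det_blockDiagonal, ← Matrix.det_reindex_self (particleEquiv m N 1).symm]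
  congr 1
  have hinj := (particleEquiv m N 1).injective
  ext ⟨k, i⟩ ⟨k', i'⟩
  have h := congrFun (congrFun (matT_pow_mul_classMat_self l z (1 + ((i' : ℕ) : ZMod (m * N))))
    (particleEquiv m N 1 (k, i))) k'
  rw [mul_classMat_apply] at h
  rw [Matrix.reindex_apply, Matrix.submatrix_apply, Equiv.symm_symm, Matrix.sub_apply,
    particleEquiv_apply 1 k' i', h, Matrix.blockDiagonal_apply, Matrix.smul_apply, Matrix.one_apply,
    Matrix.mul_apply]
  simp only [classMat, Matrix.of_apply, ← particleEquiv_apply, hinj.eq_iff, Prod.mk.injEq]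
  by_cases hi : i = i'
  · subst hi
    simp [Matrix.one_apply]
  · simp [hi]

end cyclic

/-! ### Coordinates in the loop algebra -/

section coordinates

variable {N : ℕ}

theorem coord_add (p : ℤ) (i j : Fin N) (u v : LoopAlg N) :
    coord p i j (u + v) = coord p i j u + coord p i j v := rfl

theorem coord_smul (p : ℤ) (i j : Fin N) (r : ℝ) (u : LoopAlg N) :
    coord p i j (r • u) = r * coord p i j u := by
  rw [coord, lamCoeff, LoopAlg.mat_smul, Matrix.smul_apply]
  exact HahnSeries.coeff_smul

/-- The coordinate functions as linear forms. -/
def coordForm (p : ℤ) (i j : Fin N) : LoopAlg N →ₗ[ℝ] ℝ where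
  toFun := coord p i j
  map_add' := coord_add p i j
  map_smul' := coord_smul p i j

theorem coord_zero (p : ℤ) (i j : Fin N) : coord p i j (0 : LoopAlg N) = 0 :=
  map_zero (coordForm p i j)

theorem coord_neg (p : ℤ) (i j : Fin N) (u : LoopAlg N) : coord p i j (-u) = -coord p i j u :=
  map_neg (coordForm p i j) u

theorem coord_sub (p : ℤ) (i j : Fin N) (u v : LoopAlg N) :
    coord p i j (u - v) = coord p i j u - coord p i j v :=
  map_sub (coordForm p i j) u v

theorem coord_sum (p : ℤ) (i j : Fin N) {ι : Type*} (s : Finset ι) (u : ι → LoopAlg N) :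
    coord p i j (∑ a ∈ s, u a) = ∑ a ∈ s, coord p i j (u a) :=
  map_sum (coordForm p i j) u s

theorem LoopAlg.ext_coord {u v : LoopAlg N} (h : ∀ p i j, coord p i j u = coord p i j v) :
    u = v := by
  apply LoopAlg.ext_mat
  ext i j n
  simpa [coord, lamCoeff] using h (-n) i j

theorem coord_eq_zero {p : ℤ} {i j : Fin N} (u : LoopAlg N)
    (h : ¬((i : ℤ) - (j : ℤ) ≡ p [ZMOD N])) : coord p i j u = 0 :=
  u.2 i j p h

/-- In degree zero the twist requires `i ≡ j` modulo `N`, so free terms are diagonal. -/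
theorem coord_zero_of_ne {i j : Fin N} (u : LoopAlg N) (h : i ≠ j) : coord 0 i j u = 0 := by
  apply coord_eq_zero
  intro hc
  apply h
  have hd : ((j : ℕ) : ℤ) ≡ (i : ℕ) [ZMOD N] := by simpa using (hc.add_right (j : ℤ)).symm
  have := (Int.natCast_modEq_iff.mp hd)
  exact Fin.ext (Nat.ModEq.eq_of_lt_of_lt this.symm i.2 j.2)

theorem coord_keep (P : ℤ → Prop) [DecidablePred P] (p : ℤ) (i j : Fin N) (u : LoopAlg N) :
    coord p i j (keep P u) = if P p then coord p i j u else 0 := by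
  change (if P (- -p) then _ else _) = _
  rw [neg_neg]
  rfl

end coordinates

/-! ### Shift, elementary factors and diagonal matrices in the loop algebra -/

section elements

variable {N : ℕ}

/-- Constant diagonal matrices. -/
def dg (d : Fin N → ℝ) : LoopAlg N := ⟨Matrix.diagonal fun k => HahnSeries.C (d k), by
  intro i j
  by_cases h : i = j
  · subst h
    rw [Matrix.diagonal_apply_eq]
    exact Twisted.const i _
  · rw [Matrix.diagonal_apply_ne _ h]
    exact Twisted.zero i j⟩

variable [NeZero N]

theorem shiftMat_mem : shiftMat N lam ∈ loopSub N := by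
  rw [shiftMat, Finset.smul_sum]
  refine Subalgebra.sum_mem _ fun k _ => ?_
  rw [Matrix.smul_single]
  apply single_mem
  simpa [lam] using twisted_single 1 (succ_sub_modEq k)

theorem lowMat_mem (v : Fin N → ℝ) :
    lowMat lam (fun k => (HahnSeries.C (v k) : LaurentSeries ℝ)) ∈ loopSub N := by
  rw [lowMat, Finset.smul_sum]
  refine Subalgebra.sum_mem _ fun k _ => ?_
  rw [Matrix.smul_single]
  apply single_mem
  have h := twisted_single (v k) (sub_succ_modEq k)
  have e : ((lam⁻¹ : (LaurentSeries ℝ)ˣ) : LaurentSeries ℝ) • (HahnSeries.C (v k) : LaurentSeries ℝ)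
      = HahnSeries.single (-(-1)) (v k) := by
    change (HahnSeries.single (1 : ℤ) (1 : ℝ)) * HahnSeries.single (0 : ℤ) _ = _
    rw [HahnSeries.single_mul_single]
    simp
  rw [e]
  exact h

/-- The shift `λ ∑ E_{k+1,k}` in the loop algebra. -/
def shift (N : ℕ) [NeZero N] : LoopAlg N := ⟨shiftMat N lam, shiftMat_mem⟩

/-- The element `λ⁻¹ ∑ v_k E_{k,k+1}` of the loop algebra. -/
def low (v : Fin N → ℝ) : LoopAlg N := ⟨lowMat lam fun k => HahnSeries.C (v k), lowMat_mem v⟩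

theorem lamCoeff_C_mul (p : ℤ) (r : ℝ) (f : LaurentSeries ℝ) :
    lamCoeff p (HahnSeries.C r * f) = r * lamCoeff p f := by
  rw [lamCoeff, HahnSeries.C_apply, HahnSeries.coeff_single_zero_mul, lamCoeff]

theorem lamCoeff_mul_C (p : ℤ) (r : ℝ) (f : LaurentSeries ℝ) :
    lamCoeff p (f * HahnSeries.C r) = lamCoeff p f * r := by
  rw [mul_comm, lamCoeff_C_mul, mul_comm]

theorem lamCoeff_lam_mul (p : ℤ) (f : LaurentSeries ℝ) :
    lamCoeff p ((lam : LaurentSeries ℝ) * f) = lamCoeff (p - 1) f := by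
  change (HahnSeries.single (-1 : ℤ) (1 : ℝ) * f).coeff (-p) = f.coeff (-(p - 1))
  rw [HahnSeries.coeff_single_mul, one_mul]
  congr 1
  ring

theorem lamCoeff_lam_inv_mul (p : ℤ) (f : LaurentSeries ℝ) :
    lamCoeff p (((lam⁻¹ : (LaurentSeries ℝ)ˣ) : LaurentSeries ℝ) * f) = lamCoeff (p + 1) f := by
  change (HahnSeries.single (1 : ℤ) (1 : ℝ) * f).coeff (-p) = f.coeff (-(p + 1))
  rw [HahnSeries.coeff_single_mul, one_mul]
  congr 1
  ring

theorem coord_low_mul (v : Fin N → ℝ) (u : LoopAlg N) (p : ℤ) (i j : Fin N) :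
    coord p i j (low v * u) = v i * coord (p + 1) (i + 1) j u := by
  rw [coord, LoopAlg.mat_mul]
  change lamCoeff p ((lowMat lam (fun k => HahnSeries.C (v k)) * u.mat) i j) = _
  rw [lowMat_mul_apply, lamCoeff_lam_inv_mul, lamCoeff_C_mul, coord]

theorem coord_mul_low (v : Fin N → ℝ) (u : LoopAlg N) (p : ℤ) (i j : Fin N) :
    coord p i j (u * low v) = coord (p + 1) i (j - 1) u * v (j - 1) := by
  rw [coord, LoopAlg.mat_mul]
  change lamCoeff p ((u.mat * lowMat lam (fun k => HahnSeries.C (v k))) i j) = _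
  rw [mul_lowMat_apply, lamCoeff_lam_inv_mul, lamCoeff_mul_C, coord]

theorem coord_shift_mul (u : LoopAlg N) (p : ℤ) (i j : Fin N) :
    coord p i j (shift N * u) = coord (p - 1) (i - 1) j u := by
  rw [coord, LoopAlg.mat_mul]
  change lamCoeff p ((shiftMat N lam * u.mat) i j) = _
  rw [shiftMat_mul_apply, lamCoeff_lam_mul, coord]

theorem coord_mul_shift (u : LoopAlg N) (p : ℤ) (i j : Fin N) :
    coord p i j (u * shift N) = coord (p - 1) i (j + 1) u := by
  rw [coord, LoopAlg.mat_mul]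
  change lamCoeff p ((u.mat * shiftMat N lam) i j) = _
  rw [mul_shiftMat_apply, lamCoeff_lam_mul, coord]

omit [NeZero N] in
theorem coord_dg_mul (d : Fin N → ℝ) (u : LoopAlg N) (p : ℤ) (i j : Fin N) :
    coord p i j (dg d * u) = d i * coord p i j u := by
  rw [coord, LoopAlg.mat_mul]
  change lamCoeff p
    ((Matrix.diagonal (fun k : Fin N => (HahnSeries.C (d k) : LaurentSeries ℝ)) * u.mat) i j) = _
  rw [Matrix.diagonal_mul, lamCoeff_C_mul, coord]

omit [NeZero N] in
theorem coord_mul_dg (d : Fin N → ℝ) (u : LoopAlg N) (p : ℤ) (i j : Fin N) :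
    coord p i j (u * dg d) = coord p i j u * d j := by
  rw [coord, LoopAlg.mat_mul]
  change lamCoeff p
    ((u.mat * Matrix.diagonal fun k : Fin N => (HahnSeries.C (d k) : LaurentSeries ℝ)) i j) = _
  rw [Matrix.mul_diagonal, lamCoeff_mul_C, coord]

omit [NeZero N] in
theorem dg_one : dg (fun _ : Fin N => (1 : ℝ)) = 1 := by
  apply LoopAlg.ext_mat
  change Matrix.diagonal _ = (1 : Matrix (Fin N) (Fin N) (LaurentSeries ℝ))
  simp

omit [NeZero N] in
theorem coord_dg (d : Fin N → ℝ) (p : ℤ) (i j : Fin N) :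
    coord p i j (dg d) = if p = 0 ∧ i = j then d i else 0 := by
  change lamCoeff p (Matrix.diagonal (fun k : Fin N => (HahnSeries.C (d k) : LaurentSeries ℝ)) i j)
    = _
  rw [Matrix.diagonal_apply]
  by_cases h : i = j
  · by_cases hp : p = 0 <;> simp [h, hp, lamCoeff, HahnSeries.C_apply]
  · simp [h, lamCoeff]

omit [NeZero N] in
theorem coord_one (p : ℤ) (i j : Fin N) :
    coord p i j (1 : LoopAlg N) = if p = 0 ∧ i = j then 1 else 0 := by
  rw [← dg_one, coord_dg]

theorem coord_shift (p : ℤ) (i j : Fin N) :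
    coord p i j (shift N) = if p = 1 ∧ i = j + 1 then 1 else 0 := by
  rw [← mul_one (shift N), coord_shift_mul, coord_one]
  simp only [sub_eq_iff_eq_add, zero_add]

theorem coord_low (v : Fin N → ℝ) (p : ℤ) (i j : Fin N) :
    coord p i j (low v) = if p = -1 ∧ i + 1 = j then v i else 0 := by
  rw [← mul_one (low v), coord_low_mul, coord_one]
  simp only [← eq_neg_iff_add_eq_zero, mul_ite, mul_one, mul_zero]

theorem coord_step_mul (v : Fin N → ℝ) (u : LoopAlg N) (p : ℤ) (i j : Fin N) :
    coord p i j ((1 + low v) * u) = coord p i j u + v i * coord (p + 1) (i + 1) j u := by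
  rw [add_mul, one_mul, coord_add, coord_low_mul]

theorem coord_mul_step (v : Fin N → ℝ) (u : LoopAlg N) (p : ℤ) (i j : Fin N) :
    coord p i j (u * (1 + low v)) = coord p i j u + coord (p + 1) i (j - 1) u * v (j - 1) := by
  rw [mul_add, mul_one, coord_add, coord_mul_low]

theorem low_add (d e : Fin N → ℝ) : low (fun k => d k + e k) = low d + low e := by
  apply LoopAlg.ext_coord
  intro p i j
  rw [coord_add, coord_low, coord_low, coord_low]
  split_ifs <;> simp

theorem low_smul (r : ℝ) (d : Fin N → ℝ) : low (fun k => r * d k) = r • low d := by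
  apply LoopAlg.ext_coord
  intro p i j
  rw [coord_smul, coord_low, coord_low]
  split_ifs <;> simp

theorem step_mul_dg_sub (v d : Fin N → ℝ) :
    (1 + low v) * dg d - dg d * (1 + low v) = low fun k => v k * (d (k + 1) - d k) := by
  apply LoopAlg.ext_coord
  intro p i j
  rw [coord_sub, coord_mul_dg, coord_dg_mul, coord_add, coord_low, coord_low, coord_one]
  by_cases h : p = -1 ∧ i + 1 = j
  · obtain ⟨rfl, rfl⟩ := h
    simp
    ring
  · by_cases h2 : p = 0 ∧ i = j
    · obtain ⟨rfl, rfl⟩ := h2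
      simp
    · simp [h, h2]

/-! ### Invertible elements -/

theorem shift_mul_low_one : shift N * low (fun _ => 1) = 1 := by
  apply LoopAlg.ext_coord
  intro p i j
  rw [coord_shift_mul, coord_low, coord_one]
  simp only [sub_add_cancel, sub_eq_neg_self]

theorem low_one_mul_shift : low (fun _ => 1) * shift N = 1 := by
  apply LoopAlg.ext_coord
  intro p i j
  rw [coord_mul_shift, coord_low, coord_one]
  simp only [add_left_inj, sub_eq_neg_self]

/-- The shift is invertible. -/
def shiftUnit (N : ℕ) [NeZero N] : (LoopAlg N)ˣ where
  val := shift N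
  inv := low fun _ => 1
  val_inv := shift_mul_low_one
  inv_val := low_one_mul_shift

/-- The series `∑ a_n λ⁻ⁿ`. -/
def descSeries (a : ℕ → ℝ) : LaurentSeries ℝ where
  coeff n := if 0 ≤ n then a n.toNat else 0
  isPWO_support' := by
    refine (BddBelow.isWF ⟨0, fun n hn => ?_⟩).isPWO
    by_contra h
    simp [h] at hn

theorem lamCoeff_descSeries (a : ℕ → ℝ) (p : ℤ) :
    lamCoeff p (descSeries a) = if p ≤ 0 then a (-p).toNat else 0 := by
  change (if 0 ≤ -p then _ else _) = _
  simp

theorem lowMat_pow_twist (l : ℝˣ) (v : Fin N → ℝ) (n : ℕ) :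
    ∀ i j : Fin N, ((lowMat l v) ^ n) i j ≠ 0 → (i : ℤ) - (j : ℤ) ≡ -n [ZMOD N] := by
  induction n with
  | zero =>
    intro i j h
    have : i = j := by
      by_contra hij
      exact h (by simp [hij])
    simp [this]
  | succ n ih =>
    intro i j h
    rw [pow_succ', lowMat_mul_apply] at h
    have h1 := ih (i + 1) j (fun h0 => h (by simp [h0]))
    have h2 := (sub_succ_modEq i).add h1
    have e1 : (i : ℤ) - ((i + 1 : Fin N) : ℤ) + (((i + 1 : Fin N) : ℤ) - j) = i - j := by ring
    have e2 : (-1 : ℤ) + -(n : ℤ) = -((n + 1 : ℕ) : ℤ) := by push_cast; ring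
    rwa [e1, e2] at h2

/-- The geometric series `∑ λ⁻ⁿ (∑ a_k E_{k,k+1})ⁿ`. -/
def geom (a : Fin N → ℝ) : LoopAlg N :=
  ⟨Matrix.of fun i j => descSeries fun n => ((lowMat 1 a) ^ n) i j, by
    intro i j p hp
    rw [Matrix.of_apply, lamCoeff_descSeries]
    split_ifs with h
    · by_contra h0
      have := lowMat_pow_twist 1 a _ i j h0
      rw [Int.toNat_of_nonneg (by omega), neg_neg] at this
      exact hp this
    · rfl⟩

theorem coord_geom (a : Fin N → ℝ) (p : ℤ) (i j : Fin N) :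
    coord p i j (geom a) = if p ≤ 0 then ((lowMat 1 a) ^ (-p).toNat) i j else 0 :=
  lamCoeff_descSeries (fun n => ((lowMat 1 a) ^ n) i j) p

theorem step_mul_geom (v : Fin N → ℝ) : (1 + low v) * geom (fun k => -v k) = 1 := by
  apply LoopAlg.ext_coord
  intro p i j
  rw [coord_step_mul, coord_geom, coord_geom, coord_one]
  rcases lt_trichotomy p 0 with h | h | h
  · obtain ⟨n, rfl⟩ : ∃ n : ℕ, p = -((n : ℤ) + 1) := ⟨(-p - 1).toNat, by omega⟩
    have e1 : (- -((n : ℤ) + 1)).toNat = n + 1 := by omega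
    have e2 : (-(-((n : ℤ) + 1) + 1)).toNat = n := by omega
    rw [if_pos (by omega), if_pos (by omega), if_neg (by omega), e1, e2, pow_succ',
      lowMat_mul_apply]
    simp
  · subst h
    simp [Matrix.one_apply]
  · rw [if_neg (by omega), if_neg (by omega), if_neg (by omega)]
    simp

theorem geom_mul_step (v : Fin N → ℝ) : geom (fun k => -v k) * (1 + low v) = 1 := by
  apply LoopAlg.ext_coord
  intro p i j
  rw [coord_mul_step, coord_geom, coord_geom, coord_one]
  rcases lt_trichotomy p 0 with h | h | h
  · obtain ⟨n, rfl⟩ : ∃ n : ℕ, p = -((n : ℤ) + 1) := ⟨(-p - 1).toNat, by omega⟩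
    have e1 : (- -((n : ℤ) + 1)).toNat = n + 1 := by omega
    have e2 : (-(-((n : ℤ) + 1) + 1)).toNat = n := by omega
    rw [if_pos (by omega), if_pos (by omega), if_neg (by omega), e1, e2, pow_succ,
      mul_lowMat_apply]
    simp
  · subst h
    simp [Matrix.one_apply]
  · rw [if_neg (by omega), if_neg (by omega), if_neg (by omega)]
    simp

/-- The elementary factor `I + λ⁻¹ ∑ v_k E_{k,k+1}` is invertible. -/
def stepUnit (v : Fin N → ℝ) : (LoopAlg N)ˣ where
  val := 1 + low v
  inv := geom fun k => -v k
  val_inv := step_mul_geom v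
  inv_val := geom_mul_step v

/-! ### The operators of the bracket -/

omit [NeZero N] in
theorem coord_opR (p : ℤ) (i j : Fin N) (u : LoopAlg N) :
    coord p i j (opR u) = (if 0 ≤ p then 1 / 2 else -1 / 2) * coord p i j u := by
  rw [opR, LinearMap.smul_apply, coord_smul, LinearMap.add_apply, coord_add, R0,
    LinearMap.sub_apply, coord_sub, Pplus, Pminus, Pzero, coord_keep, coord_keep, coord_keep]
  rcases lt_trichotomy p 0 with h | h | h
  · simp [h, h.not_gt, h.ne, h.not_ge]
    ring
  · simp [h]
  · simp [h, h.not_gt, h.ne', h.le]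

omit [NeZero N] in
theorem Pzero_eq (u : LoopAlg N) : Pzero u = dg fun k => coord 0 k k u := by
  apply LoopAlg.ext_coord
  intro p i j
  rw [Pzero, coord_keep, coord_dg]
  by_cases hp : p = 0
  · subst hp
    by_cases h : i = j
    · simp [h]
    · simp [h, coord_zero_of_ne u h]
  · simp [hp]

omit [NeZero N] in
theorem Pi0_eq (u : LoopAlg N) : Pi0 u = dg fun k => ∑ j, coord 0 j j u * piSign j k := rfl

omit [NeZero N] in
-- For `X = d'φ` and `Y = dφ` this is the right multiplier in the Hamiltonian field; `opD_add_opC`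
-- is the left one. Each differs from a value of `R` by a constant diagonal matrix depending only on
-- the free term of `X - Y`.
theorem opA_add_opB (X Y : LoopAlg N) : opA X + opB Y = opR X + dg fun k =>
    (1 / 2 : ℝ) * (-(coord 0 k k X - coord 0 k k Y)
      + ∑ j, (coord 0 j j X - coord 0 j j Y) * piSign j k) := by
  simp only [opA, opB, opR, LinearMap.smul_apply, LinearMap.add_apply, LinearMap.sub_apply,
    Pzero_eq, Pi0_eq]
  apply LoopAlg.ext_coord
  intro p i j
  simp only [coord_add, coord_sub, coord_smul, coord_dg]
  split_ifs
  · simp only [sub_mul, Finset.sum_sub_distrib]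
    ring
  · ring

omit [NeZero N] in
theorem opD_add_opC (X Y : LoopAlg N) : opD Y + opC X = opR Y + dg fun k =>
    (1 / 2 : ℝ) * ((coord 0 k k X - coord 0 k k Y)
      + ∑ j, (coord 0 j j X - coord 0 j j Y) * piSign j k) := by
  simp only [opC, opD, opR, LinearMap.smul_apply, LinearMap.add_apply, LinearMap.sub_apply,
    Pzero_eq, Pi0_eq]
  apply LoopAlg.ext_coord
  intro p i j
  simp only [coord_add, coord_sub, coord_smul, coord_dg]
  split_ifs
  · simp only [sub_mul, Finset.sum_sub_distrib]
    ring
  · ring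

/-- Multiplication by the factor mixes only the degrees `p` and `p + 1`, on which `R` acts by the
same scalar unless `p = -1`. Outside that degree the intertwining of `X` and `Y` passes to `R(X)`
and `R(Y)`. -/
theorem opR_step (v : Fin N → ℝ) (X Y : LoopAlg N) (h : (1 + low v) * X = Y * (1 + low v)) :
    (1 + low v) * opR X - opR Y * (1 + low v)
      = low fun k => v k * (coord 0 (k + 1) (k + 1) X - coord 0 k k Y) := by
  apply LoopAlg.ext_coord
  intro p i j
  have h' := congrArg (coord p i j) h
  rw [coord_step_mul, coord_mul_step] at h'
  rw [coord_sub, coord_step_mul, coord_mul_step, coord_opR, coord_opR, coord_opR, coord_opR,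
    coord_low]
  rcases lt_trichotomy p (-1) with hp | hp | hp
  · rw [if_neg (by omega), if_neg (by omega), if_neg (by omega)]
    linear_combination (-1 / 2) * h'
  -- Here degree `-1` carries the scalar `-1/2` and degree `0` carries `1/2`; the mismatch consists
  -- of free terms, hence sits on the entries `(k, k+1)`.
  · subst hp
    rw [if_neg (by omega), if_pos (by omega)]
    by_cases hij : i + 1 = j
    · subst hij
      simp only [neg_add_cancel, add_sub_cancel_right, and_self, if_true] at h' ⊢
      linear_combination (-1 / 2) * h'
    · have hij' : i ≠ j - 1 := fun h0 => hij (by rw [h0, sub_add_cancel])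
      simp only [neg_add_cancel, coord_zero_of_ne X hij, coord_zero_of_ne Y hij', hij] at h' ⊢
      simp only [mul_zero, zero_mul, add_zero, and_false, if_false] at h' ⊢
      linear_combination (-1 / 2) * h'
  · rw [if_pos (by omega), if_pos (by omega), if_neg (by omega)]
    linear_combination (1 / 2) * h'

/-- The shift is homogeneous, so both sides involve a single degree and `R` acts on them by the same
scalar. -/
theorem opR_shift (X Y : LoopAlg N) (h : shift N * X = Y * shift N) :
    shift N * opR X = opR Y * shift N := by
  apply LoopAlg.ext_coord
  intro p i j
  have h' := congrArg (coord p i j) h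
  rw [coord_shift_mul, coord_mul_shift] at h'
  rw [coord_shift_mul, coord_mul_shift, coord_opR, coord_opR, h']

end elements

/-! ### The scalar product -/

section pairing

variable {N : ℕ}

theorem inner0_eq (u v : LoopAlg N) : inner0 u v = ∑ k, coord 0 k k (u * v) := by
  rw [inner0, Matrix.trace, lamCoeff, HahnSeries.coeff_sum]
  rfl

theorem inner0_comm (u v : LoopAlg N) : inner0 u v = inner0 v u := by
  rw [inner0, inner0, LoopAlg.mat_mul, LoopAlg.mat_mul, Matrix.trace_mul_comm]

theorem inner0_mul_left (u v w : LoopAlg N) : inner0 (u * v) w = inner0 u (v * w) := by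
  rw [inner0_eq, inner0_eq, mul_assoc]

theorem inner0_mul_right (u v w : LoopAlg N) : inner0 u (v * w) = inner0 (w * u) v := by
  rw [inner0_comm, inner0_mul_left, inner0_comm, inner0_mul_left, inner0_comm, inner0_mul_left]

theorem inner0_add (u v w : LoopAlg N) : inner0 u (v + w) = inner0 u v + inner0 u w := by
  simp only [inner0_eq, mul_add, coord_add, Finset.sum_add_distrib]

theorem inner0_sub (u v w : LoopAlg N) : inner0 u (v - w) = inner0 u v - inner0 u w := by
  simp only [inner0_eq, mul_sub, coord_sub, Finset.sum_sub_distrib]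

theorem inner0_zero (u : LoopAlg N) : inner0 u 0 = 0 := by
  simp only [inner0_eq, mul_zero, coord_zero, Finset.sum_const_zero]

theorem inner0_low [NeZero N] (u : LoopAlg N) (w : Fin N → ℝ) :
    inner0 u (low w) = ∑ k, w k * coord 1 (k + 1) k u := by
  rw [inner0_comm, inner0_eq]
  simp only [coord_low_mul, zero_add]

end pairing

/-! ### Products of elementary factors -/

section chains

variable {N : ℕ} [NeZero N]

/-- The product `Q_{n-1} ⋯ Q_0 S` of elementary factors `Q_i = I + λ⁻¹ ∑ V_{i,k} E_{k,k+1}` and the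
shift, as an invertible element. -/
def chainUnit (V : ℕ → Fin N → ℝ) : ℕ → (LoopAlg N)ˣ
  | 0 => shiftUnit N
  | n + 1 => stepUnit (V n) * chainUnit V n

/-- The product `Q_{n-1} ⋯ Q_0 S`. -/
def chain (V : ℕ → Fin N → ℝ) (n : ℕ) : LoopAlg N := chainUnit V n

/-- The derivative of the product `Q_{n-1} ⋯ Q_0 S` in the direction `W`. -/
def dchain (V W : ℕ → Fin N → ℝ) : ℕ → LoopAlg N
  | 0 => 0
  | n + 1 => low (W n) * chain V n + (1 + low (V n)) * dchain V W n

theorem chain_zero (V : ℕ → Fin N → ℝ) : chain V 0 = shift N := rfl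

theorem chain_succ (V : ℕ → Fin N → ℝ) (n : ℕ) :
    chain V (n + 1) = (1 + low (V n)) * chain V n := rfl

theorem mat_chain (V : ℕ → Fin N → ℝ) (n : ℕ) :
    (chain V n).mat
      = stepProd lam (fun i k => (HahnSeries.C (V i k) : LaurentSeries ℝ)) n * shiftMat N lam := by
  induction n with
  | zero =>
    rw [stepProd, one_mul]
    rfl
  | succ n ih =>
    rw [chain_succ, LoopAlg.mat_mul, ih, stepProd, mul_assoc]
    rfl

/-- The conjugate of `X` by the first `n` factors. -/
def conj (V : ℕ → Fin N → ℝ) (X : LoopAlg N) (n : ℕ) : LoopAlg N :=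
  chain V n * X * ((chainUnit V n)⁻¹ : (LoopAlg N)ˣ)

/-- The gradient with respect to the `n`-th factor of a function on the products. -/
def facGrad (V : ℕ → Fin N → ℝ) (X : LoopAlg N) (n : ℕ) : LoopAlg N :=
  chain V n * X * ((chainUnit V (n + 1))⁻¹ : (LoopAlg N)ˣ)

theorem conj_mul_chain (V : ℕ → Fin N → ℝ) (X : LoopAlg N) (n : ℕ) :
    conj V X n * chain V n = chain V n * X := by
  rw [conj, chain, mul_assoc, Units.inv_mul, mul_one]

theorem step_mul_facGrad (V : ℕ → Fin N → ℝ) (X : LoopAlg N) (n : ℕ) :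
    (1 + low (V n)) * facGrad V X n = conj V X (n + 1) := by
  rw [facGrad, conj, chain_succ, mul_assoc, mul_assoc, mul_assoc]

theorem inv_chain_mul_step (V : ℕ → Fin N → ℝ) (n : ℕ) :
    (((chainUnit V (n + 1))⁻¹ : (LoopAlg N)ˣ) : LoopAlg N) * (1 + low (V n))
      = ((chainUnit V n)⁻¹ : (LoopAlg N)ˣ) := by
  change (((chainUnit V (n + 1))⁻¹ : (LoopAlg N)ˣ) : LoopAlg N) * (stepUnit (V n) : LoopAlg N) = _
  rw [← Units.val_mul, chainUnit, mul_inv_rev, inv_mul_cancel_right]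

theorem facGrad_mul_step (V : ℕ → Fin N → ℝ) (X : LoopAlg N) (n : ℕ) :
    facGrad V X n * (1 + low (V n)) = conj V X n := by
  rw [facGrad, conj, mul_assoc, inv_chain_mul_step]

theorem step_mul_conj (V : ℕ → Fin N → ℝ) (X : LoopAlg N) (n : ℕ) :
    (1 + low (V n)) * conj V X n = conj V X (n + 1) * (1 + low (V n)) := by
  rw [← facGrad_mul_step, ← mul_assoc, step_mul_facGrad]

/-- The partial derivative of a function on the products with respect to `V_{n,k}`. -/
def partialGrad (V : ℕ → Fin N → ℝ) (X : LoopAlg N) (n : ℕ) (k : Fin N) : ℝ :=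
  coord 1 (k + 1) k (facGrad V X n)

/-- The two conjugates are `Q F` and `F Q` for the same `F`, so their difference is the commutator
of `F` with the degree `-1` part of `Q`; its free term sees `F` only in degree `1`, where the
partial derivatives are. -/
theorem conj_free_succ (V : ℕ → Fin N → ℝ) (X : LoopAlg N) (n : ℕ) (k : Fin N) :
    coord 0 (k + 1) (k + 1) (conj V X (n + 1)) - coord 0 (k + 1) (k + 1) (conj V X n)
      = V n (k + 1) * partialGrad V X n (k + 1) - V n k * partialGrad V X n k := by
  rw [← step_mul_facGrad, ← facGrad_mul_step, coord_step_mul, coord_mul_step, partialGrad,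
    partialGrad, add_sub_cancel_right, zero_add]
  ring

/-- The Leibniz rule together with cyclicity of the trace: each variation of a factor is paired with
the product of everything else. It justifies reading `partialGrad` as partial derivatives. -/
theorem inner0_dchain (V W : ℕ → Fin N → ℝ) (X : LoopAlg N) (n : ℕ) :
    inner0 (X * (((chainUnit V n)⁻¹ : (LoopAlg N)ˣ) : LoopAlg N)) (dchain V W n)
      = ∑ i ∈ Finset.range n, ∑ k, W i k * partialGrad V X i k := by
  induction n with
  | zero => simp [dchain, inner0_zero]
  | succ n ih =>
    rw [dchain, inner0_add, Finset.sum_range_succ, ← ih, add_comm, ← inner0_mul_left, mul_assoc,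
      inv_chain_mul_step, inner0_mul_right, ← mul_assoc]
    change _ + inner0 (facGrad V X n) _ = _
    rw [inner0_low]
    rfl

/-- Inserting the variations of the factors into the Leibniz rule makes the sum telescope, leaving
only the multipliers at the two ends. -/
theorem dchain_eq_of_intertwine (V W : ℕ → Fin N → ℝ) (Z : ℕ → LoopAlg N) (Y : LoopAlg N)
    (h0 : shift N * Y = Z 0 * shift N) (n : ℕ)
    (h : ∀ i < n, (1 + low (V i)) * Z i - Z (i + 1) * (1 + low (V i)) = low (W i)) :
    dchain V W n = chain V n * Y - Z n * chain V n := by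
  induction n with
  | zero => rw [dchain, chain_zero, h0, sub_self]
  | succ n ih =>
    rw [dchain, ih fun i hi => h i (by omega), ← h n (by omega), chain_succ]
    noncomm_ring

/-- Away from the wrap-around both sides are the sum of `d_j` over `j > k` minus the sum over `j ≤
k`. This property of `Π` matches the diagonal corrections on the two sides of the shift. -/
theorem piSign_succ (d : Fin N → ℝ) (hd : ∑ k, d k = 0) (k : Fin N) :
    d (k + 1) + ∑ j, d j * piSign j (k + 1) = -d k + ∑ j, d j * piSign j k := by
  have e1 : d (k + 1) = ∑ j, d j * (if j = k + 1 then 1 else 0) := by simp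
  have e2 : -d k = ∑ j, d j * (if j = k then -1 else 0) := by simp
  rw [e1, e2, ← Finset.sum_add_distrib, ← Finset.sum_add_distrib]
  simp only [← mul_add]
  obtain ⟨n, rfl⟩ : ∃ n, N = n + 1 := ⟨N - 1, (Nat.succ_pred_eq_of_ne_zero (NeZero.ne N)).symm⟩
  -- At the wrap-around the left side is `∑ d` and the right side is `-∑ d`; only here is the
  -- vanishing of the sum needed.
  by_cases hk : k = Fin.last n
  · subst hk
    have h1 : ∑ j, d j * ((if j = Fin.last n + 1 then 1 else 0) + piSign j (Fin.last n + 1)) = 0 := by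
      refine (Finset.sum_congr rfl fun j _ => ?_).trans hd
      rw [Fin.last_add_one, piSign]
      rcases eq_or_ne j 0 with h | h
      · simp [h]
      · simp [h, Fin.pos_iff_ne_zero]
    have h2 : ∑ j, d j * ((if j = Fin.last n then -1 else 0) + piSign j (Fin.last n)) = 0 := by
      have h3 : ∑ j, -d j = 0 := by rw [Finset.sum_neg_distrib, hd, neg_zero]
      refine (Finset.sum_congr rfl fun j _ => ?_).trans h3
      rw [piSign]
      rcases eq_or_ne j (Fin.last n) with h | h
      · simp [h]
      · simp [h, Fin.lt_last_iff_ne_last.mpr h, (Fin.le_last j).not_gt]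
    rw [h1, h2]
  · have hv : ((k + 1 : Fin (n + 1)) : ℕ) = k + 1 :=
      Fin.val_add_one_of_lt (Fin.lt_last_iff_ne_last.mpr hk)
    refine Finset.sum_congr rfl fun j _ => ?_
    congr 1
    simp only [piSign, Fin.ext_iff, Fin.lt_def, hv]
    rcases lt_trichotomy (j : ℕ) k with h | h | h
    · rw [if_neg (by omega), if_neg (by omega), if_pos (by omega), if_neg (by omega),
        if_neg (by omega), if_pos (by omega)]
    · rw [if_neg (by omega), if_neg (by omega), if_pos (by omega), if_pos (by omega),
        if_neg (by omega), if_neg (by omega)]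
      ring
    · rw [if_neg (show ¬(j : ℕ) = k by omega), if_pos h]
      rcases Nat.lt_or_ge (k + 1) j with h' | h'
      · rw [if_neg (by omega), if_pos (by omega)]
      · rw [if_pos (by omega), if_neg (by omega), if_neg (by omega)]
        ring

/-- The components of the Hamiltonian vector field with the gradient `G` in terms of the
parameters of the factors. -/
theorem dchain_hamiltonian (V W : ℕ → Fin N → ℝ) (G : LoopAlg N) (n : ℕ)
    (hW : ∀ i < n, ∀ k, W i k = V i k * (coord 0 (k + 1) (k + 1) (conj V (G * chain V n) i)
      - coord 0 k k (conj V (G * chain V n) (i + 1))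
      - (coord 0 k k (G * chain V n) - coord 0 k k (chain V n * G)))) :
    dchain V W n = chain V n * opA (G * chain V n) - opD (chain V n * G) * chain V n
      + chain V n * opB (chain V n * G) - opC (G * chain V n) * chain V n := by
  set X := G * chain V n with hX
  set Y := chain V n * G with hY
  set d : Fin N → ℝ := fun k => coord 0 k k X - coord 0 k k Y with hd
  set κ : Fin N → ℝ := fun k => (1 / 2 : ℝ) * (d k + ∑ j, d j * piSign j k) with hκ
  set κ' : Fin N → ℝ := fun k => (1 / 2 : ℝ) * (-d k + ∑ j, d j * piSign j k) with hκ'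
  -- `X` and `Y` are the two orders of one product, so their free traces agree.
  have hd0 : ∑ k, d k = 0 := by
    rw [hd, Finset.sum_sub_distrib, ← inner0_eq, ← inner0_eq, inner0_comm, sub_self]
  have hs : ∀ k, κ (k + 1) = κ' k := fun k => by
    simp only [hκ, hκ', piSign_succ d hd0 k]
  have hA : opA X + opB Y = opR X + dg κ' := opA_add_opB X Y
  have hD : opD Y + opC X = opR Y + dg κ := opD_add_opC X Y
  -- The multiplier between factors is `R` of the conjugate plus the same diagonal `κ` throughout.
  -- Past the shift, on the far right, `κ` becomes `κ'`.
  have key : dchain V W n = chain V n * (opR X + dg κ')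
      - (opR (conj V X n) + dg κ) * chain V n := by
    refine dchain_eq_of_intertwine V W (fun i => opR (conj V X i) + dg κ) _ ?_ n fun i hi => ?_
    · rw [mul_add, add_mul]
      congr 1
      · exact opR_shift _ _ (conj_mul_chain V X 0).symm
      · apply LoopAlg.ext_coord
        intro p i j
        rw [coord_mul_dg, coord_dg_mul, coord_shift]
        by_cases h : p = 1 ∧ i = j + 1
        · rw [if_pos h, h.2, hs]
          ring
        · simp [h]
    · have e : W i = fun k => V i k * (coord 0 (k + 1) (k + 1) (conj V X i)
          - coord 0 k k (conj V X (i + 1))) + V i k * (κ (k + 1) - κ k) := by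
        funext k
        rw [hW i hi k, hs]
        simp only [hκ, hκ', hd]
        ring
      rw [e, low_add, ← step_mul_dg_sub, ← opR_step _ _ _ (step_mul_conj V X i)]
      noncomm_ring
  have hm : conj V X n = Y := by
    rw [conj, hX, chain, ← mul_assoc, mul_assoc, Units.mul_inv, mul_one, hY, chain]
  rw [key, hm, ← hA, ← hD]
  noncomm_ring

end chains

/-! ### Degrees occurring in the products, and their leading coefficients -/

section bounds

variable {N : ℕ} [NeZero N]

theorem coord_chain_of_one_lt (V : ℕ → Fin N → ℝ) (n : ℕ) :
    ∀ p i j, 1 < p → coord p i j (chain V n) = 0 := by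
  induction n with
  | zero =>
    intro p i j hp
    rw [chain_zero, coord_shift, if_neg (by omega)]
  | succ n ih =>
    intro p i j hp
    rw [chain_succ, coord_step_mul, ih _ _ _ hp, ih _ _ _ (by omega), mul_zero, add_zero]

theorem coord_chain_one (V : ℕ → Fin N → ℝ) (n : ℕ) (i j : Fin N) :
    coord 1 i j (chain V n) = if i = j + 1 then 1 else 0 := by
  induction n with
  | zero => rw [chain_zero, coord_shift]; simp
  | succ n ih =>
    rw [chain_succ, coord_step_mul, ih, coord_chain_of_one_lt V n _ _ _ (by omega), mul_zero,
      add_zero]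

theorem coord_chain_zero (V : ℕ → Fin N → ℝ) (n : ℕ) (k : Fin N) :
    coord 0 k k (chain V n) = ∑ i ∈ Finset.range n, V i k := by
  induction n with
  | zero => rw [chain_zero, coord_shift]; simp
  | succ n ih =>
    rw [chain_succ, coord_step_mul, ih, zero_add, coord_chain_one, if_pos rfl, mul_one,
      Finset.sum_range_succ]

theorem coord_chain_of_lt (V : ℕ → Fin N → ℝ) (n : ℕ) :
    ∀ p i j, p < 1 - (n : ℤ) → coord p i j (chain V n) = 0 := by
  induction n with
  | zero =>
    intro p i j hp
    rw [chain_zero, coord_shift, if_neg]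
    push_cast at hp
    omega
  | succ n ih =>
    intro p i j hp
    push_cast at hp
    rw [chain_succ, coord_step_mul, ih _ _ _ (by omega), ih _ _ _ (by omega), mul_zero, add_zero]

theorem coord_dchain_of_pos (V W : ℕ → Fin N → ℝ) (n : ℕ) :
    ∀ p i j, 0 < p → coord p i j (dchain V W n) = 0 := by
  induction n with
  | zero => exact fun p i j _ => coord_zero p i j
  | succ n ih =>
    intro p i j hp
    rw [dchain, coord_add, coord_low_mul, coord_step_mul, ih _ _ _ hp, ih _ _ _ (by omega),
      coord_chain_of_one_lt V n _ _ _ (by omega)]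
    ring

theorem coord_dchain_zero (V W : ℕ → Fin N → ℝ) (n : ℕ) (k : Fin N) :
    coord 0 k k (dchain V W n) = ∑ i ∈ Finset.range n, W i k := by
  induction n with
  | zero => rw [dchain, coord_zero]; simp
  | succ n ih =>
    rw [dchain, coord_add, coord_low_mul, coord_step_mul, ih, zero_add, coord_chain_one,
      coord_dchain_of_pos V W n _ _ _ (by omega), Finset.sum_range_succ, if_pos rfl]
    ring

theorem coord_dchain_of_lt (V W : ℕ → Fin N → ℝ) (n : ℕ) :
    ∀ p i j, p < 1 - (n : ℤ) → coord p i j (dchain V W n) = 0 := by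
  induction n with
  | zero => exact fun p i j _ => coord_zero p i j
  | succ n ih =>
    intro p i j hp
    push_cast at hp
    rw [dchain, coord_add, coord_low_mul, coord_step_mul, ih _ _ _ (by omega), ih _ _ _ (by omega),
      coord_chain_of_lt V n _ _ _ (by omega)]
    ring

end bounds

/-! ### Hamiltonian vector fields on the loop matrices -/

section lattice

variable {m N : ℕ} [NeZero m] [NeZero N]

/-- The loop matrix `Q_n ⋯ Q_{n-m+1} S` in the loop algebra. -/
def loopChain (m N : ℕ) [NeZero N] (n : ZMod (m * N)) (z : ZMod (m * N) → ℝ) : LoopAlg N :=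
  chain (slots m N z n) m

/-- The derivative of the loop matrix in the direction `w`. -/
def dloopChain (m N : ℕ) [NeZero N] (n : ZMod (m * N)) (z w : ZMod (m * N) → ℝ) : LoopAlg N :=
  dchain (slots m N z n) (slots m N w n) m

omit [NeZero m] in
theorem mat_loopChain (n : ZMod (m * N)) (z : ZMod (m * N) → ℝ) :
    (loopChain m N n z).mat = loopMat m N lam (constSeries z) n :=
  mat_chain _ _

omit [NeZero m] in
theorem loopL_eq (z : ZMod (m * N) → ℝ) {j : ℕ} (hj : j ∈ Finset.Icc 1 m) :
    loopL m N j z = loopChain m N j z := by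
  apply LoopAlg.ext_mat
  rw [mat_loopChain, ← matL_eq _ _ hj]
  rfl

omit [NeZero m] in
theorem loopV_eq (z : ZMod (m * N) → ℝ) (j : ℕ) :
    loopV m N j z = 1 + low (slot m N z j) := by
  apply LoopAlg.ext_mat
  change matV m N lam (constSeries z) j = _
  rw [matV_eq]
  rfl

omit [NeZero m] in
theorem loopU_eq (z : ZMod (m * N) → ℝ) :
    loopU m N z = (1 + low (slot m N z 1)) * shift N := by
  apply LoopAlg.ext_mat
  change matU m N lam (constSeries z) = _
  rw [matU_eq]
  rfl

theorem loopChain_mul_step (n : ZMod (m * N)) (z : ZMod (m * N) → ℝ) :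
    loopChain m N n z * (1 + low (slot m N z n))
      = (1 + low (slot m N z n)) * loopChain m N (n - 1) z := by
  apply LoopAlg.ext_mat
  rw [LoopAlg.mat_mul, LoopAlg.mat_mul, mat_loopChain, mat_loopChain]
  exact loopMat_mul_stepMat lam (constSeries z) n

omit [NeZero m] in
theorem shift_mul_loopChain (n : ZMod (m * N)) (z : ZMod (m * N) → ℝ) :
    shift N * loopChain m N n z = loopChain m N (n - m) z * shift N := by
  apply LoopAlg.ext_mat
  rw [LoopAlg.mat_mul, LoopAlg.mat_mul, mat_loopChain, mat_loopChain]
  exact shiftMat_mul_loopMat lam (constSeries z) n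

omit [NeZero m] in
theorem isUnit_loopW (z : ZMod (m * N) → ℝ) (j : ℕ) : IsUnit (loopW m N j z) := by
  rw [loopW]
  split_ifs
  · rw [loopU_eq]
    exact (stepUnit (slot m N z 1) * shiftUnit N).isUnit
  · rw [loopV_eq]
    exact (stepUnit (slot m N z j)).isUnit

omit [NeZero m] [NeZero N] in
theorem cast_cycPred {j : ℕ} (hj : j ∈ Finset.Icc 1 m) (h1 : j ≠ 1) :
    ((cycPred m j : ℕ) : ZMod (m * N)) = (j : ZMod (m * N)) - 1 := by
  rw [cycPred, if_neg h1, Nat.cast_sub (Finset.mem_Icc.mp hj).1, Nat.cast_one]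

theorem cycPred_mem {j : ℕ} (hj : j ∈ Finset.Icc 1 m) : cycPred m j ∈ Finset.Icc 1 m := by
  rw [cycPred]
  rw [Finset.mem_Icc] at hj ⊢
  have := NeZero.pos m
  split_ifs <;> omega

theorem loopL_mul_loopW (z : ZMod (m * N) → ℝ) {j : ℕ} (hj : j ∈ Finset.Icc 1 m) :
    loopL m N j z * loopW m N j z = loopW m N j z * loopL m N (cycPred m j) z := by
  rw [loopL_eq z hj, loopL_eq z (cycPred_mem hj), loopW]
  split_ifs with h
  · subst h
    rw [loopU_eq, mul_assoc, cycPred, if_pos rfl, shift_mul_loopChain, sub_self, ← mul_assoc,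
      ← mul_assoc, Nat.cast_one, loopChain_mul_step, sub_self]
  · rw [loopV_eq, loopChain_mul_step, cast_cycPred hj h]

/-- The first particle of the factors of the `n`-th loop matrix. -/
def base (m N : ℕ) (n : ZMod (m * N)) : ZMod (m * N) := n - m + 1

omit [NeZero m] [NeZero N] in
theorem slots_eq (z : ZMod (m * N) → ℝ) (n : ZMod (m * N)) (i : ℕ) (k : Fin N) :
    slots m N z n i k
      = z ((m : ZMod (m * N)) * ((k : ℕ) : ZMod (m * N)) + (base m N n + (i : ZMod (m * N)))) :=
  rfl

/-- The gradient of a function on the loop matrices in the coordinates of the lattice. -/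
def latticeGrad (n : ZMod (m * N)) (z : ZMod (m * N) → ℝ) (G : LoopAlg N) (a : ZMod (m * N)) : ℝ :=
  partialGrad (slots m N z n) (G * loopChain m N n z)
    (((particleEquiv m N (base m N n)).symm a).2 : ℕ) ((particleEquiv m N (base m N n)).symm a).1

theorem latticeGrad_particle (n : ZMod (m * N)) (z : ZMod (m * N) → ℝ) (G : LoopAlg N) {i : ℕ}
    (hi : i < m) (k : Fin N) :
    latticeGrad n z G
        ((m : ZMod (m * N)) * ((k : ℕ) : ZMod (m * N)) + (base m N n + (i : ZMod (m * N))))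
      = partialGrad (slots m N z n) (G * loopChain m N n z) i k := by
  have h : (particleEquiv m N (base m N n)).symm
      ((m : ZMod (m * N)) * ((k : ℕ) : ZMod (m * N)) + (base m N n + (i : ZMod (m * N))))
        = (k, ⟨i, hi⟩) := by
    rw [Equiv.symm_apply_eq]
    rfl
  rw [latticeGrad, h]

theorem sum_slots (n : ZMod (m * N)) (f : ZMod (m * N) → ℝ) :
    ∑ i ∈ Finset.range m, ∑ k, slots m N f n i k = ∑ a, f a := by
  rw [← Equiv.sum_comp (particleEquiv m N (base m N n)) f, Fintype.sum_prod_type, Finset.sum_comm]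
  refine Finset.sum_congr rfl fun k _ => ?_
  rw [← Fin.sum_univ_eq_sum_range (fun i => slots m N f n i k)]
  rfl

theorem inner0_dloopChain (n : ZMod (m * N)) (z w : ZMod (m * N) → ℝ) (G : LoopAlg N) :
    inner0 G (dloopChain m N n z w) = ∑ a, w a * latticeGrad n z G a := by
  rw [← sum_slots n]
  have h := inner0_dchain (slots m N z n) (slots m N w n) (G * loopChain m N n z) m
  rw [loopChain, chain, mul_assoc, Units.mul_inv, mul_one] at h
  rw [dloopChain, h]
  refine Finset.sum_congr rfl fun i hi => Finset.sum_congr rfl fun k _ => ?_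
  rw [slots_eq, slots_eq, latticeGrad_particle n z G (Finset.mem_range.mp hi)]
  rfl

theorem latticeGrad_eq (n : ZMod (m * N)) (z : ZMod (m * N) → ℝ) (G : LoopAlg N)
    (a : ZMod (m * N)) :
    latticeGrad n z G a = inner0 G (dloopChain m N n z (Pi.single a 1)) := by
  rw [inner0_dloopChain]
  simp [Pi.single_apply]

/-- The identity is the gradient of `tr(u)_0`, which on the family is the sum of all particles. -/
theorem latticeGrad_one (n : ZMod (m * N)) (z : ZMod (m * N) → ℝ) (a : ZMod (m * N)) :
    latticeGrad n z 1 a = 1 := by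
  rw [latticeGrad_eq, inner0_eq]
  simp only [one_mul, dloopChain, coord_dchain_zero]
  rw [Finset.sum_comm, sum_slots]
  simp

omit [NeZero m] [NeZero N] in
-- Reversing the backward sum pairs the forward neighbour `b + r + 1` with the backward neighbour
-- lying exactly `m`, that is one block, below it.
theorem sum_Icc_sub_eq (η : ZMod (m * N) → ℝ) (b : ZMod (m * N)) :
    ∑ r ∈ Finset.Icc 1 (m - 1), η (b + (r : ZMod (m * N)))
        - ∑ r ∈ Finset.Icc 1 (m - 1), η (b - (r : ZMod (m * N)))
      = ∑ r ∈ Finset.range (m - 1),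
          (η (b + (r : ZMod (m * N)) + 1) - η (b + (r : ZMod (m * N)) + 1 - m)) := by
  have hI : Finset.Icc 1 (m - 1) = Finset.Ico (0 + 1) (m - 1 + 1) := by
    ext x
    simp only [Finset.mem_Icc, Finset.mem_Ico]
    omega
  rw [Finset.sum_sub_distrib, hI, ← Finset.sum_Ico_add', ← Finset.sum_Ico_add',
    Nat.Ico_zero_eq_range]
  congr 1
  · refine Finset.sum_congr rfl fun r _ => ?_
    push_cast
    rw [add_assoc]
  · rw [← Finset.sum_range_reflect]
    refine Finset.sum_congr rfl fun r hr => ?_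
    have hr' := Finset.mem_range.mp hr
    have e : ((m - 1 - 1 - r + 1 : ℕ) : ZMod (m * N)) = m - 1 - r := by
      have : m - 1 - 1 - r + 1 = m - (1 + r) := by omega
      rw [this, Nat.cast_sub (by omega)]
      push_cast
      ring
    rw [e]
    congr 1
    ring

/-- The sum over the neighbours telescopes. -/
theorem sum_neighbours (η : ZMod (m * N) → ℝ) (c : ZMod (m * N)) (t : ℕ → Fin N → ℝ)
    (d : Fin N → ℝ)
    (hη : ∀ i < m, ∀ k : Fin N, t (i + 1) (k + 1) - t i (k + 1)
      = η ((m : ZMod (m * N)) * (((k + 1 : Fin N) : ℕ) : ZMod (m * N)) + (c + (i : ZMod (m * N))))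
        - η ((m : ZMod (m * N)) * ((k : ℕ) : ZMod (m * N)) + (c + (i : ZMod (m * N)))))
    (ht : ∀ k, t 0 (k + 1) = t m k + d k) {i : ℕ} (hi : i < m) (k : Fin N) :
    ∑ r ∈ Finset.Icc 1 (m - 1), η ((m : ZMod (m * N)) * ((k : ℕ) : ZMod (m * N))
          + (c + (i : ZMod (m * N))) + (r : ZMod (m * N)))
        - ∑ r ∈ Finset.Icc 1 (m - 1), η ((m : ZMod (m * N)) * ((k : ℕ) : ZMod (m * N))
          + (c + (i : ZMod (m * N))) - (r : ZMod (m * N)))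
      = t i (k + 1) - t (i + 1) k - d k := by
  rw [sum_Icc_sub_eq]
  -- This continues `t` at block `k` past `s = m` into block `k + 1`. Subtracting `d k` makes the
  -- two pieces agree at `s = m`, so that the telescoping runs across the block boundary.
  set u : ℕ → ℝ := fun s => if s ≤ m then t s k else t (s - m) (k + 1) - d k with hu
  have hm := NeZero.pos m
  have hk : (m : ZMod (m * N)) * ((k : ℕ) : ZMod (m * N))
      = (m : ZMod (m * N)) * (((k - 1 : Fin N) : ℕ) : ZMod (m * N)) + m := by
    rw [← cast_fin_succ, sub_add_cancel]
  have hum : u m = t (m - m) (k + 1) - d k := by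
    simp only [hu, le_refl, if_true, Nat.sub_self]
    rw [ht]
    ring
  have hstep : ∀ r ∈ Finset.range (m - 1),
      η ((m : ZMod (m * N)) * ((k : ℕ) : ZMod (m * N)) + (c + (i : ZMod (m * N)))
          + (r : ZMod (m * N)) + 1)
        - η ((m : ZMod (m * N)) * ((k : ℕ) : ZMod (m * N)) + (c + (i : ZMod (m * N)))
          + (r : ZMod (m * N)) + 1 - m)
      = u (i + 1 + (r + 1)) - u (i + 1 + r) := by
    intro r hr
    have hr' := Finset.mem_range.mp hr
    rcases lt_or_ge (i + 1 + r) m with h | h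
    · have h1 := hη (i + 1 + r) h (k - 1)
      simp only [sub_add_cancel] at h1
      simp only [hu]
      rw [if_pos (by omega), if_pos (by omega), show i + 1 + (r + 1) = i + 1 + r + 1 from rfl, h1]
      congr 2
      · push_cast
        ring
      · rw [hk]
        push_cast
        ring
    · have h1 := hη (i + 1 + r - m) (by omega) k
      have h2 : u (i + 1 + r) = t (i + 1 + r - m) (k + 1) - d k := by
        rcases h.eq_or_lt with h' | h'
        · rw [← h', hum]
        · simp only [hu]
          rw [if_neg (by omega)]
      have h3 : u (i + 1 + (r + 1)) = t (i + 1 + r - m + 1) (k + 1) - d k := by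
        simp only [hu]
        rw [if_neg (by omega)]
        congr 2
        omega
      rw [h2, h3, sub_sub_sub_cancel_right, h1, Nat.cast_sub h, cast_fin_succ]
      congr 2
      · push_cast
        ring
      · push_cast
        ring
  rw [Finset.sum_congr rfl hstep, Finset.sum_range_sub (fun r => u (i + 1 + r))]
  have e1 : u (i + 1 + (m - 1)) = t i (k + 1) - d k := by
    have : i + 1 + (m - 1) = i + m := by omega
    rw [this]
    rcases Nat.eq_zero_or_pos i with h | h
    · rw [h, zero_add, hum, Nat.sub_self]
    · simp only [hu]
      rw [if_neg (by omega), Nat.add_sub_cancel]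
  have e2 : u (i + 1 + 0) = t (i + 1) k := by
    simp only [hu]
    rw [if_pos (by omega), add_zero]
  rw [e1, e2]
  ring

/-- The Hamiltonian vector field on the phase space of the lattice of a function with the partial
derivatives `f`. -/
def latticeHam (m N : ℕ) (z f : ZMod (m * N) → ℝ) (b : ZMod (m * N)) : ℝ :=
  z b * (∑ r ∈ Finset.Icc 1 (m - 1), z (b + (r : ZMod (m * N))) * f (b + (r : ZMod (m * N)))
    - ∑ r ∈ Finset.Icc 1 (m - 1), z (b - (r : ZMod (m * N))) * f (b - (r : ZMod (m * N))))

omit [NeZero m] [NeZero N] in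
theorem latticeHam_one (z : ZMod (m * N) → ℝ) :
    latticeHam m N z (fun _ => 1) = latticeField m N z := by
  funext b
  simp [latticeHam, latticeField]

/-- Tangency with explicit components: the free terms of the successive conjugates supply the
telescoping function, and the derivative of the family along the lattice field is the field of the
loop algebra. -/
theorem dloopChain_latticeHam (n : ZMod (m * N)) (z : ZMod (m * N) → ℝ) (G : LoopAlg N) :
    dloopChain m N n z (latticeHam m N z (latticeGrad n z G))
      = loopChain m N n z * opA (G * loopChain m N n z)
        - opD (loopChain m N n z * G) * loopChain m N n z
        + loopChain m N n z * opB (loopChain m N n z * G)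
        - opC (G * loopChain m N n z) * loopChain m N n z := by
  refine dchain_hamiltonian _ _ G m fun i hi k => ?_
  change z _ * _ = z _ * _
  congr 1
  set X := G * chain (slots m N z n) m with hX
  refine sum_neighbours (fun b => z b * latticeGrad n z G b) (base m N n)
    (fun i k => coord 0 k k (conj (slots m N z n) X i))
    (fun k => coord 0 k k X - coord 0 k k (chain (slots m N z n) m * G)) ?_ ?_ hi k
  · intro i hi k
    simp only [latticeGrad_particle n z G hi]
    exact conj_free_succ _ _ _ _
  · intro k
    have hm : conj (slots m N z n) X m = chain (slots m N z n) m * G := by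
      rw [conj, hX, chain, ← mul_assoc, mul_assoc, Units.mul_inv, mul_one]
    -- The zeroth conjugate is `S X S⁻¹`, so its free term at `k + 1` is that of `X` at `k`; the
    -- last conjugate is `Y`. Their difference is the correction `d`.
    have h0 := congrArg (coord 1 (k + 1) k) (conj_mul_chain (slots m N z n) X 0)
    rw [chain_zero, coord_mul_shift, coord_shift_mul, sub_self, add_sub_cancel_right] at h0
    rw [hm, h0]
    ring

/-- The case `G = 1`: here `X = Y = L`, the diagonal corrections vanish and both multipliers become
`R(L)`. -/
theorem dloopChain_latticeField (n : ZMod (m * N)) (z : ZMod (m * N) → ℝ) :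
    dloopChain m N n z (latticeField m N z)
      = loopChain m N n z * opR (loopChain m N n z)
        - opR (loopChain m N n z) * loopChain m N n z := by
  have h := dloopChain_latticeHam n z 1
  have h1 : latticeGrad n z 1 = fun _ => 1 := funext (latticeGrad_one n z)
  have hA := opA_add_opB (loopChain m N n z) (loopChain m N n z)
  have hD := opD_add_opC (loopChain m N n z) (loopChain m N n z)
  have h0 : dg (fun _ : Fin N => (0 : ℝ)) = 0 := by
    apply LoopAlg.ext_coord
    intro p i j
    rw [coord_dg, coord_zero, ite_self]
  simp only [sub_self, neg_zero, zero_mul, Finset.sum_const_zero, add_zero, mul_zero, h0] at hA hD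
  rw [h1, latticeHam_one, one_mul, mul_one] at h
  rw [h]
  conv_rhs =>
    congr
    · rw [← hA]
    · rw [← hD]
  noncomm_ring

omit [NeZero N] in
theorem sum_range_pred (f : ℕ → ℝ) :
    ∑ i ∈ Finset.range m, f i = ∑ i ∈ Finset.range (m - 1), f (i + 1) + f 0 ∧
      ∑ i ∈ Finset.range m, f i = ∑ i ∈ Finset.range (m - 1), f i + f (m - 1) := by
  obtain ⟨q, hq⟩ : ∃ q, m = q + 1 := ⟨m - 1, (Nat.succ_pred_eq_of_ne_zero (NeZero.ne m)).symm⟩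
  rw [hq]
  exact ⟨Finset.sum_range_succ' f q, Finset.sum_range_succ f q⟩

/-- By `opR_step` only free terms matter. That of `L_{n-1}` at `k + 1` sums `z_{mk+n}, …,
z_{mk+n+m-1}`, that of `L_n` at `k` sums `z_{mk+n-m+1}, …, z_{mk+n}`. -/
theorem step_opR_loopChain (n : ZMod (m * N)) (z : ZMod (m * N) → ℝ) :
    (1 + low (slot m N z n)) * opR (loopChain m N (n - 1) z)
        - opR (loopChain m N n z) * (1 + low (slot m N z n))
      = low (slot m N (latticeField m N z) n) := by
  rw [opR_step _ _ _ (loopChain_mul_step n z).symm]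
  congr 1
  funext k
  change z _ * _ = z _ * _
  congr 1
  rw [sum_Icc_sub_eq, loopChain, loopChain, coord_chain_zero, coord_chain_zero]
  rw [(sum_range_pred (m := m) _).1, (sum_range_pred (m := m) (fun i => slots m N z n i k)).2,
    Finset.sum_sub_distrib]
  -- The particle `z_{mk+n}` is common to both sums and cancels.
  have e1 : slots m N z (n - 1) 0 (k + 1) = slots m N z n (m - 1) k := by
    rw [slots_eq, slots_eq, cast_fin_succ, base, base, Nat.cast_sub NeZero.one_le]
    congr 1
    push_cast
    ring
  rw [e1, add_sub_add_right_eq_sub]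
  congr 1
  · refine Finset.sum_congr rfl fun r _ => ?_
    rw [slots_eq, cast_fin_succ, base]
    congr 1
    push_cast
    ring
  · refine Finset.sum_congr rfl fun r _ => ?_
    rw [slots_eq, base]
    congr 1
    ring

end lattice

/-! ### Smoothness and derivatives of the loop matrices -/

section calculus

variable {N : ℕ} [NeZero N]

theorem hasCurveDeriv_chain {V : ℝ → ℕ → Fin N → ℝ} {W : ℕ → Fin N → ℝ} {t : ℝ}
    (h : ∀ i k, HasDerivAt (fun s => V s i k) (W i k) t) (n : ℕ) :
    HasCurveDeriv (fun s => chain (V s) n) (dchain (V t) W n) t := by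
  induction n with
  | zero =>
    intro p i j
    rw [dchain, coord_zero]
    exact hasDerivAt_const t _
  | succ n ih =>
    intro p i j
    simp only [chain_succ, coord_step_mul, dchain, coord_add, coord_low_mul]
    exact ((ih p i j).add ((h n i).mul (ih (p + 1) (i + 1) j))).congr_deriv (by ring)

theorem analyticAt_coord_chain {E : Type*} [NormedAddCommGroup E] [NormedSpace ℝ E]
    {V : E → ℕ → Fin N → ℝ} {z : E} (h : ∀ i k, AnalyticAt ℝ (fun y => V y i k) z) (n : ℕ) :
    ∀ p i j, AnalyticAt ℝ (fun y => coord p i j (chain (V y) n)) z := by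
  induction n with
  | zero => exact fun p i j => analyticAt_const
  | succ n ih =>
    intro p i j
    simp only [chain_succ, coord_step_mul]
    exact (ih p i j).add ((h n i).mul (ih (p + 1) (i + 1) j))

theorem analyticAt_coord_dchain {E : Type*} [NormedAddCommGroup E] [NormedSpace ℝ E]
    {V : E → ℕ → Fin N → ℝ} {z : E} (h : ∀ i k, AnalyticAt ℝ (fun y => V y i k) z)
    (W : ℕ → Fin N → ℝ) (n : ℕ) :
    ∀ p i j, AnalyticAt ℝ (fun y => coord p i j (dchain (V y) W n)) z := by
  induction n with
  | zero =>
    intro p i j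
    simp only [dchain, coord_zero]
    exact analyticAt_const
  | succ n ih =>
    intro p i j
    simp only [dchain, coord_add, coord_low_mul, coord_step_mul]
    exact (analyticAt_const.mul (analyticAt_coord_chain h n _ _ _)).add
      ((ih p i j).add ((h n i).mul (ih (p + 1) (i + 1) j)))

end calculus

/-! ### Finite-dimensional spaces of bounded degree and the chain rule -/

section frames

variable {N : ℕ}

/-- The element `λ ^ p E_{ij}` of the loop algebra. -/
def twistedElem {p : ℤ} {i j : Fin N} (h : (i : ℤ) - (j : ℤ) ≡ p [ZMOD N]) : LoopAlg N :=
  ⟨Matrix.single i j (HahnSeries.single (-p) 1), single_mem (twisted_single 1 h)⟩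

open Classical in
/-- The element `λ ^ p E_{ij}` of the loop algebra, or zero if it violates the twist. -/
def elem (p : ℤ) (i j : Fin N) : LoopAlg N :=
  if h : (i : ℤ) - (j : ℤ) ≡ p [ZMOD N] then twistedElem h else 0

theorem coord_elem_of_ne {p q : ℤ} {i j a b : Fin N} (h : ¬(p = q ∧ i = a ∧ j = b)) :
    coord q a b (elem p i j) = 0 := by
  rw [elem]
  split_ifs with hc
  · change lamCoeff q (Matrix.single i j (HahnSeries.single (-p) (1 : ℝ)) a b) = 0
    rw [Matrix.single_apply]
    split_ifs with hij
    · rw [lamCoeff, HahnSeries.coeff_single_of_ne]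
      intro hpq
      exact h ⟨(neg_injective hpq).symm, hij⟩
    · rfl
  · exact coord_zero q a b

theorem coord_mul_coord_elem (p : ℤ) (i j : Fin N) (u : LoopAlg N) :
    coord p i j u * coord p i j (elem p i j) = coord p i j u := by
  by_cases hc : (i : ℤ) - (j : ℤ) ≡ p [ZMOD N]
  · rw [elem, dif_pos hc]
    change _ * lamCoeff p (Matrix.single i j (HahnSeries.single (-p) (1 : ℝ)) i j) = _
    rw [Matrix.single_apply_same, lamCoeff, HahnSeries.coeff_single_same, mul_one]
  · rw [coord_eq_zero u hc, zero_mul]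

theorem sum_coord_smul_elem (K : ℤ) (u : LoopAlg N)
    (hu : ∀ p i j, K < |p| → coord p i j u = 0) :
    ∑ x : Finset.Icc (-K) K × Fin N × Fin N, coord (x.1 : ℤ) x.2.1 x.2.2 u
      • elem (x.1 : ℤ) x.2.1 x.2.2 = u := by
  apply LoopAlg.ext_coord
  intro q a b
  rw [coord_sum]
  simp only [coord_smul]
  by_cases hq : q ∈ Finset.Icc (-K) K
  · rw [Finset.sum_eq_single (⟨q, hq⟩, a, b)]
    · exact coord_mul_coord_elem q a b u
    · rintro ⟨⟨p, hp⟩, i, j⟩ _ hne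
      rw [coord_elem_of_ne, mul_zero]
      rintro ⟨h1, h2, h3⟩
      subst h1 h2 h3
      exact hne rfl
    · simp
  · rw [hu q a b, Finset.sum_eq_zero]
    · rintro ⟨⟨p, hp⟩, i, j⟩ _
      rw [coord_elem_of_ne, mul_zero]
      rintro ⟨h1, -, -⟩
      subst h1
      exact hq hp
    · by_contra hc
      exact hq (Finset.mem_Icc.mpr (abs_le.mp (not_lt.mp hc)))

/-- Smoothness is assumed only on finite-dimensional affine subspaces. A family of bounded degree
stays in one such subspace, so composites with it can be differentiated there. -/
theorem exists_frame (N : ℕ) (K : ℤ) : ∃ (n : ℕ) (P : Fin n → ℤ × Fin N × Fin N)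
    (X : Fin n → LoopAlg N), ∀ u : LoopAlg N, (∀ p i j, K < |p| → coord p i j u = 0) →
      ∑ a, coord (P a).1 (P a).2.1 (P a).2.2 u • X a = u := by
  let e := Fintype.equivFin (Finset.Icc (-K) K × Fin N × Fin N)
  refine ⟨_, fun a => (((e.symm a).1 : ℤ), (e.symm a).2), fun a =>
    elem ((e.symm a).1 : ℤ) (e.symm a).2.1 (e.symm a).2.2, fun u hu => ?_⟩
  exact (Equiv.sum_comp e.symm fun x => coord (x.1 : ℤ) x.2.1 x.2.2 u
    • elem (x.1 : ℤ) x.2.1 x.2.2).trans (sum_coord_smul_elem K u hu)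

/-- The chain rule for smooth functions along families with a bounded range of powers of `λ`. -/
theorem hasFDerivAt_comp_family {E : Type*} [NormedAddCommGroup E] [NormedSpace ℝ E]
    {F : E → LoopAlg N} {dF : E → E → LoopAlg N} {K : ℤ}
    (hF : ∀ z p i j, K < |p| → coord p i j (F z) = 0)
    (hdF : ∀ z w p i j, K < |p| → coord p i j (dF z w) = 0)
    (hd : ∀ p i j, Differentiable ℝ fun z => coord p i j (F z))
    (hder : ∀ z w, HasCurveDeriv (fun ε : ℝ => F (z + ε • w)) (dF z w) 0)
    {φ : LoopAlg N → ℝ} (hφ : IsSmooth φ) {z : E} {G : LoopAlg N} (hG : HasGrad φ (F z) G) :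
    ∃ f' : E →L[ℝ] ℝ, HasFDerivAt (φ ∘ F) f' z ∧ ∀ w, f' w = inner0 G (dF z w) := by
  obtain ⟨n, P, X, hX⟩ := exists_frame N K
  set τ : E → Fin n → ℝ := fun y a => coord (P a).1 (P a).2.1 (P a).2.2 (F y) with hτ
  set g : (Fin n → ℝ) → ℝ := fun t => φ (0 + ∑ a, t a • X a) with hg
  have hcomp : φ ∘ F = g ∘ τ := by
    funext y
    simp only [Function.comp_apply, hg, hτ, zero_add]
    rw [hX (F y) (hF y)]
  have hgd : HasFDerivAt g (fderiv ℝ g (τ z)) (τ z) :=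
    (((hφ.1 n 0 X).differentiable (by simp)) (τ z)).hasFDerivAt
  have hτd : DifferentiableAt ℝ τ z := differentiableAt_pi.mpr fun a => hd _ _ _ z
  have hf := hgd.comp z hτd.hasFDerivAt
  rw [← hcomp] at hf
  refine ⟨_, hf, fun w => ?_⟩
  set s : Fin n → ℝ := fun a => coord (P a).1 (P a).2.1 (P a).2.2 (dF z w) with hs
  have hline : HasDerivAt (fun ε : ℝ => z + ε • w) w 0 := by
    simpa using ((hasDerivAt_id (0 : ℝ)).smul_const w).const_add z
  have hτs : fderiv ℝ τ z w = s := by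
    have h1 : HasDerivAt (fun ε : ℝ => τ (z + ε • w)) s 0 :=
      hasDerivAt_pi.mpr fun a => hder z w _ _ _
    have h2 : HasDerivAt (fun ε : ℝ => τ (z + ε • w)) (fderiv ℝ τ z w) 0 := by
      have h0 : HasFDerivAt τ (fderiv ℝ τ z) ((fun ε : ℝ => z + ε • w) 0) := by
        simpa using hτd.hasFDerivAt
      exact h0.comp_hasDerivAt (0 : ℝ) hline
    exact h2.unique h1
  rw [ContinuousLinearMap.comp_apply, hτs]
  have hline' : HasDerivAt (fun ε : ℝ => τ z + ε • s) s 0 := by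
    simpa using ((hasDerivAt_id (0 : ℝ)).smul_const s).const_add (τ z)
  have h3 : HasDerivAt (fun ε : ℝ => g (τ z + ε • s)) (fderiv ℝ g (τ z) s) 0 := by
    have h0 : HasFDerivAt g (fderiv ℝ g (τ z)) ((fun ε : ℝ => τ z + ε • s) 0) := by
      simpa using hgd
    exact h0.comp_hasDerivAt (0 : ℝ) hline'
  -- The curve itself need not be a line, whereas a gradient only controls lines. The derivative of
  -- `g` is therefore compared with that along the tangent line at `F z`.
  have h4 : (fun ε : ℝ => g (τ z + ε • s)) = fun ε : ℝ => φ (F z + ε • dF z w) := by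
    funext ε
    simp only [hg, zero_add, Pi.add_apply, Pi.smul_apply, add_smul, smul_assoc,
      Finset.sum_add_distrib, ← Finset.smul_sum]
    rw [hX (F z) (hF z), hX (dF z w) (hdF z w)]
  rw [h4] at h3
  exact h3.unique (hG (dF z w))

theorem hasGrad_grad {φ : LoopAlg N → ℝ} (hφ : IsSmooth φ) (u : LoopAlg N) :
    HasGrad φ u (grad φ u) := by
  rw [grad, dif_pos (hφ.2 u)]
  exact (hφ.2 u).choose_spec

end frames

/-! ### The loop matrices as a Poisson submanifold -/

section families

variable {m N : ℕ} [NeZero m] [NeZero N]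

omit [NeZero m] in
theorem hasCurveDeriv_loopChain {z : ℝ → ZMod (m * N) → ℝ} {w : ZMod (m * N) → ℝ} {t : ℝ}
    (h : ∀ a, HasDerivAt (fun s => z s a) (w a) t) (n : ZMod (m * N)) :
    HasCurveDeriv (fun s => loopChain m N n (z s)) (dloopChain m N n (z t) w) t :=
  hasCurveDeriv_chain (V := fun s => slots m N (z s) n) (fun _ _ => h _) m

omit [NeZero m] in
theorem hasCurveDeriv_loopChain_line (n : ZMod (m * N)) (z w : ZMod (m * N) → ℝ) :
    HasCurveDeriv (fun ε : ℝ => loopChain m N n (z + ε • w)) (dloopChain m N n z w) 0 := by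
  have h := hasCurveDeriv_loopChain (z := fun ε : ℝ => z + ε • w) (w := w) (t := 0)
    (fun a => by simpa using ((hasDerivAt_id (0 : ℝ)).mul_const (w a)).const_add (z a)) n
  simpa using h

theorem analyticAt_slots (n : ZMod (m * N)) (z : ZMod (m * N) → ℝ) (i : ℕ) (k : Fin N) :
    AnalyticAt ℝ (fun y => slots m N y n i k) z :=
  (ContinuousLinearMap.proj (R := ℝ) (φ := fun _ : ZMod (m * N) => ℝ) _).analyticAt z

theorem analyticAt_coord_loopChain (n : ZMod (m * N)) (z : ZMod (m * N) → ℝ) (p : ℤ)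
    (i j : Fin N) : AnalyticAt ℝ (fun y => coord p i j (loopChain m N n y)) z :=
  analyticAt_coord_chain (analyticAt_slots n z) m p i j

theorem analyticAt_coord_dloopChain (n : ZMod (m * N)) (z w : ZMod (m * N) → ℝ) (p : ℤ)
    (i j : Fin N) : AnalyticAt ℝ (fun y => coord p i j (dloopChain m N n y w)) z :=
  analyticAt_coord_dchain (analyticAt_slots n z) _ m p i j

omit [NeZero m] in
theorem coord_loopChain_eq_zero (n : ZMod (m * N)) (z : ZMod (m * N) → ℝ) (p : ℤ) (i j : Fin N)
    (hp : ((m : ℤ) + 1) < |p|) : coord p i j (loopChain m N n z) = 0 := by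
  rcases lt_abs.mp hp with h | h
  · exact coord_chain_of_one_lt _ _ _ _ _ (by omega)
  · exact coord_chain_of_lt _ _ _ _ _ (by omega)

omit [NeZero m] in
theorem coord_dloopChain_eq_zero (n : ZMod (m * N)) (z w : ZMod (m * N) → ℝ) (p : ℤ)
    (i j : Fin N) (hp : ((m : ℤ) + 1) < |p|) : coord p i j (dloopChain m N n z w) = 0 := by
  rcases lt_abs.mp hp with h | h
  · exact coord_dchain_of_pos _ _ _ _ _ _ (by omega)
  · exact coord_dchain_of_lt _ _ _ _ _ _ (by omega)

theorem fderiv_comp_loopChain (n : ZMod (m * N)) {φ : LoopAlg N → ℝ} (hφ : IsSmooth φ)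
    (z w : ZMod (m * N) → ℝ) :
    fderiv ℝ (φ ∘ loopChain m N n) z w
      = inner0 (grad φ (loopChain m N n z)) (dloopChain m N n z w) := by
  obtain ⟨f', h1, h2⟩ := hasFDerivAt_comp_family (F := loopChain m N n) (dF := dloopChain m N n)
    (K := (m : ℤ) + 1) (coord_loopChain_eq_zero n) (coord_dloopChain_eq_zero n)
    (fun p i j z => (analyticAt_coord_loopChain n z p i j).differentiableAt)
    (hasCurveDeriv_loopChain_line n) hφ (hasGrad_grad hφ (loopChain m N n z))
  rw [h1.fderiv, h2]

theorem sum_latticeBracket (z f : ZMod (m * N) → ℝ) (b : ZMod (m * N)) :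
    ∑ a, latticeBracket m N a b z * f a = latticeHam m N z f b := by
  simp only [latticeBracket, latticeHam, Finset.sum_mul, mul_sub, Finset.mul_sum,
    ← Finset.sum_sub_distrib]
  rw [Finset.sum_comm]
  refine Finset.sum_congr rfl fun r _ => ?_
  have e (a : ZMod (m * N)) :
      (b = a + (r : ZMod (m * N))) = (a = b - (r : ZMod (m * N))) := by
    rw [eq_sub_iff_add_eq]
    exact propext eq_comm
  simp only [sub_mul, Finset.sum_sub_distrib, ite_mul, one_mul, zero_mul, e]
  rw [Finset.sum_ite_eq' Finset.univ, Finset.sum_ite_eq' Finset.univ]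
  simp only [Finset.mem_univ, if_true]
  ring

theorem coordBracket_latticeBracket (f h : (ZMod (m * N) → ℝ) → ℝ) (z : ZMod (m * N) → ℝ) :
    coordBracket (latticeBracket m N) f h z
      = ∑ b, latticeHam m N z (fun a => fderiv ℝ f z (Pi.single a 1)) b
          * fderiv ℝ h z (Pi.single b 1) := by
  rw [coordBracket, Finset.sum_comm]
  refine Finset.sum_congr rfl fun b _ => ?_
  rw [← sum_latticeBracket, Finset.sum_mul]

theorem coordBracket_coordinate (f : (ZMod (m * N) → ℝ) → ℝ) (z : ZMod (m * N) → ℝ)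
    (b : ZMod (m * N)) :
    coordBracket (latticeBracket m N) f (fun y => y b) z
      = latticeHam m N z (fun a => fderiv ℝ f z (Pi.single a 1)) b := by
  rw [coordBracket_latticeBracket, (hasFDerivAt_apply b z).fderiv]
  simp [Pi.single_apply]

omit [NeZero N] in
-- By invariance of the trace form the bracket is the derivative of `ψ` along the field of `φ`, so
-- the Poisson property of the parametrization will follow from tangency.
theorem inner0_hamField (φ : LoopAlg N → ℝ) (ψ : LoopAlg N → ℝ) (u : LoopAlg N) :
    inner0 (grad ψ u) (hamField opA opB opC opD φ u) = PB opA opB opC opD φ ψ u := by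
  have h1 (v : LoopAlg N) : inner0 v (dR ψ u) = inner0 (grad ψ u) (u * v) := by
    rw [dR, inner0_mul_right, inner0_comm]
  have h2 (v : LoopAlg N) : inner0 v (dL ψ u) = inner0 (grad ψ u) (v * u) := by
    rw [dL, inner0_mul_right, inner0_mul_left]
  rw [PB, h1, h2, h1, h2, hamField, inner0_sub, inner0_add, inner0_sub]

theorem dloopChain_hamField (n : ZMod (m * N)) {φ : LoopAlg N → ℝ} (hφ : IsSmooth φ)
    (z : ZMod (m * N) → ℝ) :
    dloopChain m N n z (latticeHam m N z fun a =>
        fderiv ℝ (φ ∘ loopChain m N n) z (Pi.single a 1))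
      = hamField opA opB opC opD φ (loopChain m N n z) := by
  have h : (fun a => fderiv ℝ (φ ∘ loopChain m N n) z (Pi.single a 1))
      = latticeGrad n z (grad φ (loopChain m N n z)) := by
    funext a
    rw [fderiv_comp_loopChain n hφ, latticeGrad_eq]
  rw [h, dloopChain_latticeHam]
  rfl

theorem isPoissonSubmanifold_loopChain (n : ZMod (m * N)) {Ω : Set (ZMod (m * N) → ℝ)}
    (ho : IsOpen Ω) (hde : Dense Ω) (him : ∀ z ∈ Ω, ∀ w, dloopChain m N n z w = 0 → w = 0) :
    IsPoissonSubmanifold opA opB opC opD (latticeBracket m N) (loopChain m N n) where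
  bounded := ⟨(m : ℤ) + 1, coord_loopChain_eq_zero n⟩
  smooth p i j := AnalyticOnNhd.contDiff fun z _ => analyticAt_coord_loopChain n z p i j
  immersion := by
    refine ⟨Ω, ho, hde, fun z hz w hw => him z hz w (LoopAlg.ext_coord fun p i j => ?_)⟩
    exact (hasCurveDeriv_loopChain_line n z w p i j).unique (hw p i j)
  poisson φ ψ hφ hψ z := by
    rw [coordBracket_latticeBracket, ← inner0_hamField, ← dloopChain_hamField n hφ,
      inner0_dloopChain]
    refine Finset.sum_congr rfl fun b _ => ?_
    rw [fderiv_comp_loopChain n hψ, latticeGrad_eq]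
  tangent φ hφ z := by
    simp only [coordBracket_coordinate]
    rw [← dloopChain_hamField n hφ]
    exact hasCurveDeriv_loopChain_line n z _

end families

/-! ### Evaluation at real values of the spectral parameter -/

section evaluation

variable {N : ℕ}

/-- Only finitely many powers of `λ` occur. -/
def FinDeg (u : LoopAlg N) : Prop := ∃ K : ℤ, ∀ p i j, K < |p| → coord p i j u = 0

/-- The value of a Laurent polynomial in `λ` at a real number. -/
def evalMat (l : ℝˣ) (u : LoopAlg N) : Matrix (Fin N) (Fin N) ℝ :=
  Matrix.of fun i j => ∑ᶠ p : ℤ, coord p i j u * (l : ℝ) ^ p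

theorem FinDeg.finite {u : LoopAlg N} (hu : FinDeg u) (l : ℝˣ) (i j : Fin N) :
    (Function.support fun p : ℤ => coord p i j u * (l : ℝ) ^ p).Finite := by
  obtain ⟨K, hK⟩ := hu
  refine (Set.finite_Icc (-K) K).subset fun p hp => ?_
  by_contra hc
  apply hp
  change _ * _ = _
  rw [hK p i j, zero_mul]
  by_contra h
  exact hc (Set.mem_Icc.mpr (abs_le.mp (not_lt.mp h)))

theorem evalMat_eq_sum {u : LoopAlg N} {K : ℤ} (hK : ∀ p i j, K < |p| → coord p i j u = 0)
    (l : ℝˣ) (i j : Fin N) :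
    evalMat l u i j = ∑ p ∈ Finset.Icc (-K) K, coord p i j u * (l : ℝ) ^ p := by
  refine finsum_eq_sum_of_support_subset _ fun p hp => ?_
  by_contra hc
  apply hp
  change _ * _ = _
  rw [hK p i j, zero_mul]
  by_contra h
  exact hc (by simpa using abs_le.mp (not_lt.mp h))

theorem FinDeg.add {u v : LoopAlg N} (hu : FinDeg u) (hv : FinDeg v) : FinDeg (u + v) := by
  obtain ⟨K, hK⟩ := hu
  obtain ⟨K', hK'⟩ := hv
  refine ⟨max K K', fun p i j hp => ?_⟩
  rw [coord_add, hK p i j (by omega), hK' p i j (by omega), add_zero]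

theorem evalMat_add (l : ℝˣ) {u v : LoopAlg N} (hu : FinDeg u) (hv : FinDeg v) :
    evalMat l (u + v) = evalMat l u + evalMat l v := by
  ext i j
  simp only [evalMat, Matrix.of_apply, Matrix.add_apply, coord_add, add_mul]
  exact finsum_add_distrib (hu.finite l i j) (hv.finite l i j)

theorem evalMat_zero (l : ℝˣ) : evalMat l (0 : LoopAlg N) = 0 := by
  ext i j
  simp [evalMat, coord_zero]

variable [NeZero N]

theorem FinDeg.low_mul {u : LoopAlg N} (hu : FinDeg u) (v : Fin N → ℝ) : FinDeg (low v * u) := by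
  obtain ⟨K, hK⟩ := hu
  refine ⟨K + 1, fun p i j hp => ?_⟩
  rw [coord_low_mul, hK _ _ _ (by rw [lt_abs] at hp ⊢; omega), mul_zero]

theorem evalMat_low_mul (l : ℝˣ) {u : LoopAlg N} (hu : FinDeg u) (v : Fin N → ℝ) :
    evalMat l (low v * u) = lowMat l v * evalMat l u := by
  ext i j
  rw [lowMat_mul_apply]
  simp only [evalMat, Matrix.of_apply, coord_low_mul]
  rw [← mul_assoc, mul_finsum' _ _ (hu.finite l _ _), ← finsum_comp_equiv (Equiv.addRight (-1 : ℤ))]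
  refine finsum_congr fun p => ?_
  rw [Equiv.coe_addRight, neg_add_cancel_right, zpow_add₀ l.ne_zero, zpow_neg_one,
    Units.val_inv_eq_inv_val]
  ring

theorem evalMat_step_mul (l : ℝˣ) {u : LoopAlg N} (hu : FinDeg u) (v : Fin N → ℝ) :
    evalMat l ((1 + low v) * u) = stepMat l v * evalMat l u := by
  rw [add_mul, one_mul, evalMat_add l hu (hu.low_mul v), evalMat_low_mul l hu, stepMat, add_mul,
    one_mul]

theorem evalMat_shift (l : ℝˣ) : evalMat l (shift N) = shiftMat N l := by
  ext i j
  rw [evalMat, Matrix.of_apply, finsum_eq_single _ 1, coord_shift, shiftMat_apply]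
  · simp only [true_and, zpow_one, ite_mul, one_mul, zero_mul]
    congr 1
    rw [eq_iff_iff]
    exact ⟨fun h => by rw [h, add_sub_cancel_right], fun h => by rw [h, sub_add_cancel]⟩
  · intro p hp
    rw [coord_shift, if_neg (fun h => hp h.1), zero_mul]

theorem finDeg_chain (V : ℕ → Fin N → ℝ) (n : ℕ) : FinDeg (chain V n) := by
  refine ⟨(n : ℤ) + 1, fun p i j hp => ?_⟩
  rcases lt_abs.mp hp with h | h
  · exact coord_chain_of_one_lt _ _ _ _ _ (by omega)
  · exact coord_chain_of_lt _ _ _ _ _ (by omega)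

theorem finDeg_dchain (V W : ℕ → Fin N → ℝ) (n : ℕ) : FinDeg (dchain V W n) := by
  refine ⟨(n : ℤ) + 1, fun p i j hp => ?_⟩
  rcases lt_abs.mp hp with h | h
  · exact coord_dchain_of_pos _ _ _ _ _ _ (by omega)
  · exact coord_dchain_of_lt _ _ _ _ _ _ (by omega)

theorem evalMat_chain (l : ℝˣ) (V : ℕ → Fin N → ℝ) (n : ℕ) :
    evalMat l (chain V n) = stepProd l V n * shiftMat N l := by
  induction n with
  | zero => rw [chain_zero, evalMat_shift, stepProd, one_mul]
  | succ n ih => rw [chain_succ, evalMat_step_mul l (finDeg_chain V n), ih, stepProd, mul_assoc]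

theorem evalMat_loopChain {m : ℕ} (l : ℝˣ) (n : ZMod (m * N)) (z : ZMod (m * N) → ℝ) :
    evalMat l (loopChain m N n z) = loopMat m N l z n :=
  evalMat_chain l _ m

theorem evalMat_dchain_succ (l : ℝˣ) (V W : ℕ → Fin N → ℝ) (n : ℕ) :
    evalMat l (dchain V W (n + 1)) = lowMat l (W n) * evalMat l (chain V n)
      + stepMat l (V n) * evalMat l (dchain V W n) := by
  have h1 := (finDeg_chain V n)
  have h2 := (finDeg_dchain V W n)
  have h3 : FinDeg ((1 + low (V n)) * dchain V W n) := by
    rw [add_mul, one_mul]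
    exact h2.add (h2.low_mul _)
  rw [dchain, evalMat_add l (h1.low_mul _) h3, evalMat_low_mul l h1, evalMat_step_mul l h2]

/-! ### Immersions -/

theorem lowMat_mulVec (l : ℝˣ) (v f : Fin N → ℝ) (k : Fin N) :
    (lowMat l v).mulVec f k = (l : ℝ)⁻¹ * (v k * f (k + 1)) := by
  simp [Matrix.mulVec, dotProduct, lowMat_apply, mul_assoc]

theorem stepMat_mulVec (l : ℝˣ) (v f : Fin N → ℝ) (k : Fin N) :
    (stepMat l v).mulVec f k = f k + (l : ℝ)⁻¹ * (v k * f (k + 1)) := by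
  rw [stepMat, Matrix.add_mulVec, Matrix.one_mulVec, Pi.add_apply, lowMat_mulVec]

/-- The cyclic shift preserves the sum of squares, which is thus multiplied by `r²`. -/
theorem eq_zero_of_add_mul_shift {r : ℝ} (hr : r ^ 2 ≠ 1) {f : Fin N → ℝ}
    (h : ∀ k, f k + r * f (k + 1) = 0) : f = 0 := by
  have h1 : ∑ k, f k ^ 2 = r ^ 2 * ∑ k, f k ^ 2 := by
    conv_rhs => rw [← Equiv.sum_comp (Equiv.addRight (1 : Fin N)), Finset.mul_sum]
    refine Finset.sum_congr rfl fun k _ => ?_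
    rw [eq_neg_of_add_eq_zero_left (h k), Equiv.coe_addRight]
    ring
  have h2 : ∑ k, f k ^ 2 = 0 := by
    by_contra hne
    exact hr (mul_right_cancel₀ hne (by rw [← h1, one_mul]))
  funext k
  have h3 := (Finset.sum_eq_zero_iff_of_nonneg fun k _ => sq_nonneg (f k)).mp h2 k
    (Finset.mem_univ k)
  exact pow_eq_zero_iff (two_ne_zero) |>.mp h3

/-- The all-ones vector is an eigenvector of the shift and of every factor with constant entries. -/
theorem evalMat_chain_mulVec (l : ℝˣ) {V : ℕ → Fin N → ℝ} {m : ℕ}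
    (hV : ∀ i < m, ∀ k, V i k = (i : ℝ) + 1) {n : ℕ} (hn : n ≤ m) :
    (evalMat l (chain V n)).mulVec 1
      = fun _ => (l : ℝ) * ∏ i ∈ Finset.range n, (1 + (l : ℝ)⁻¹ * ((i : ℝ) + 1)) := by
  induction n with
  | zero =>
    funext k
    simp [chain_zero, evalMat_shift, Matrix.mulVec, dotProduct, shiftMat_apply]
  | succ n ih =>
    funext k
    rw [chain_succ, evalMat_step_mul l (finDeg_chain V n), ← Matrix.mulVec_mulVec,
      ih (by omega), stepMat_mulVec, hV n hn, Finset.prod_range_succ]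
    ring

/-- At a point where the elementary factors are distinct constants, the product of the factors
determines the factors to first order. -/
theorem eq_zero_of_dchain_eq_zero {V W : ℕ → Fin N → ℝ} {m : ℕ}
    (hV : ∀ i < m, ∀ k, V i k = (i : ℝ) + 1) (h : dchain V W m = 0) :
    ∀ i < m, W i = 0 := by
  intro i
  induction i using Nat.strong_induction_on with
  | _ i ih =>
  intro hi
  have hne : (-((i : ℝ) + 1)) ≠ 0 := by
    have : (0 : ℝ) < (i : ℝ) + 1 := by positivity
    linarith
  -- At this value of `λ` the `i`-th factor annihilates the all-ones vector and no other factor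
  -- does.
  set l : ℝˣ := Units.mk0 (-((i : ℝ) + 1)) hne with hl
  have hlv : (l : ℝ) = -((i : ℝ) + 1) := rfl
  have hfac (n : ℕ) : 1 + (l : ℝ)⁻¹ * ((n : ℝ) + 1) = 0 → n = i := by
    intro h0
    have h1 : (l : ℝ) + ((n : ℝ) + 1) = 0 := by
      have := congrArg ((l : ℝ) * ·) h0
      simpa [mul_add, l.ne_zero] using this
    rw [hlv] at h1
    exact_mod_cast (by linarith : (n : ℝ) = i)
  set D : ℕ → Fin N → ℝ := fun n => (evalMat l (dchain V W n)).mulVec 1 with hD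
  have hsucc (n : ℕ) (k : Fin N) : D (n + 1) k
      = (l : ℝ)⁻¹ * (W n k * (evalMat l (chain V n)).mulVec 1 (k + 1))
        + (D n k + (l : ℝ)⁻¹ * (V n k * D n (k + 1))) := by
    simp only [hD]
    rw [evalMat_dchain_succ, Matrix.add_mulVec, ← Matrix.mulVec_mulVec, ← Matrix.mulVec_mulVec,
      Pi.add_apply, lowMat_mulVec, stepMat_mulVec]
  -- The variations of the earlier factors vanish by induction.
  have hlow : ∀ n ≤ i, D n = 0 := by
    intro n hn
    induction n with
    | zero => simp [hD, dchain, evalMat_zero]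
    | succ n ihn =>
      funext k
      rw [hsucc, ihn (by omega), ih n hn (by omega)]
      simp
  -- Variations of later factors act after the `i`-th factor has killed the vector, so they
  -- contribute nothing; the later factors themselves are injective because `r = -(i+n+2)/(i+1)` has
  -- `r² ≠ 1`, and can be cancelled. What remains is a nonzero multiple of the variation of the
  -- `i`-th factor.
  have hhigh : ∀ n, i + 1 + n ≤ m → D (i + 1 + n) = 0 → D (i + 1) = 0 := by
    intro n
    induction n with
    | zero => exact fun _ h0 => h0
    | succ n ihn =>
      intro hn h0
      refine ihn (by omega) (eq_zero_of_add_mul_shift (r := (l : ℝ)⁻¹ * (((i + 1 + n : ℕ) : ℝ) + 1))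
        ?_ fun k => ?_)
      · intro hr
        have h1 : (((i + 1 + n : ℕ) : ℝ) + 1) ^ 2 = (l : ℝ) ^ 2 := by
          have := congrArg ((l : ℝ) ^ 2 * ·) hr
          simpa [mul_pow, ← mul_assoc, l.ne_zero] using this
        rw [hlv, neg_sq] at h1
        push_cast at h1
        have hn0 : (0 : ℝ) ≤ n := Nat.cast_nonneg n
        have hi0 : (0 : ℝ) ≤ i := Nat.cast_nonneg i
        nlinarith
      · have h2 := congrFun h0 k
        rw [← add_assoc, hsucc, evalMat_chain_mulVec l hV (by omega), hV _ (by omega)] at h2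
        have h3 : ∏ a ∈ Finset.range (i + 1 + n), (1 + (l : ℝ)⁻¹ * ((a : ℝ) + 1)) = 0 := by
          refine Finset.prod_eq_zero (i := i) (Finset.mem_range.mpr (by omega)) ?_
          rw [hlv, inv_neg, neg_mul, inv_mul_cancel₀ (by positivity)]
          ring
        rw [h3] at h2
        simp only [mul_zero, zero_add, Pi.zero_apply] at h2
        rw [← h2]
        ring
  have hDm : D m = 0 := by
    simp [hD, h, evalMat_zero]
  have hfin : D (i + 1) = 0 := by
    refine hhigh (m - (i + 1)) (by omega) ?_
    rw [show i + 1 + (m - (i + 1)) = m by omega, hDm]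
  funext k
  have h4 := congrFun hfin k
  rw [hsucc, hlow i le_rfl, evalMat_chain_mulVec l hV hi.le] at h4
  simp only [Pi.zero_apply, mul_zero, add_zero, mul_eq_zero, inv_eq_zero, l.ne_zero,
    false_or] at h4
  rcases h4 with h4 | h4
  · exact h4
  · obtain ⟨a, ha, ha0⟩ := Finset.prod_eq_zero_iff.mp h4
    have := hfac a ha0
    rw [Finset.mem_range] at ha
    omega

theorem dchain_add (V W W' : ℕ → Fin N → ℝ) (n : ℕ) :
    dchain V (fun i k => W i k + W' i k) n = dchain V W n + dchain V W' n := by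
  induction n with
  | zero => simp [dchain]
  | succ n ih =>
    rw [dchain, ih, low_add, dchain, dchain]
    noncomm_ring

theorem dchain_smul (V W : ℕ → Fin N → ℝ) (r : ℝ) (n : ℕ) :
    dchain V (fun i k => r * W i k) n = r • dchain V W n := by
  induction n with
  | zero => simp [dchain]
  | succ n ih =>
    rw [dchain, ih, low_smul, dchain, smul_add, smul_mul_assoc, mul_smul_comm]

end evaluation

/-! ### From injectivity at one point to a dense open set -/

section generic

/-- A family of linear maps with analytic entries which is injective at one point is injective on a
dense open set. -/
theorem exists_dense_open_injective {E ι κ : Type*} [NormedAddCommGroup E] [NormedSpace ℝ E]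
    [Fintype ι] [DecidableEq ι] [Fintype κ] (J : E → (ι → ℝ) →ₗ[ℝ] (κ → ℝ))
    (hJ : ∀ z w a, AnalyticAt ℝ (fun y => J y w a) z) {z₀ : E}
    (h₀ : ∀ w, J z₀ w = 0 → w = 0) :
    ∃ Ω : Set E, IsOpen Ω ∧ Dense Ω ∧ ∀ z ∈ Ω, ∀ w, J z w = 0 → w = 0 := by
  -- Composing with a fixed left inverse at `z₀` gives square matrices, whose determinant is
  -- analytic in `z` and equals `1` at `z₀`.
  obtain ⟨K, hK⟩ := (J z₀).exists_leftInverse_of_injective (LinearMap.ker_eq_bot'.mpr h₀)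
  set f : E → ℝ := fun z => (LinearMap.toMatrix' (K ∘ₗ J z)).det with hf
  have hfa : AnalyticOnNhd ℝ f Set.univ := by
    intro z _
    have hentry (a b : ι) : AnalyticAt ℝ (fun y => LinearMap.toMatrix' (K ∘ₗ J y) a b) z := by
      simp only [LinearMap.toMatrix'_apply, LinearMap.comp_apply]
      have h1 : AnalyticAt ℝ (fun y => J y (Pi.single b 1)) z :=
        analyticAt_pi_iff.mpr fun c => hJ z _ c
      exact ((ContinuousLinearMap.proj (R := ℝ) (φ := fun _ : ι => ℝ) a
        ∘L LinearMap.toContinuousLinearMap K).analyticAt _).comp h1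
    simp only [hf, Matrix.det_apply']
    exact Finset.analyticAt_fun_sum _ fun σ _ => analyticAt_const.mul
      (Finset.analyticAt_fun_prod _ fun a _ => hentry _ _)
  have hcont : Continuous f := continuous_iff_continuousAt.mpr fun z => (hfa z trivial).continuousAt
  refine ⟨{z | f z ≠ 0}, isOpen_ne_fun hcont continuous_const, ?_, ?_⟩
  · intro z
    rw [mem_closure_iff_frequently]
    intro hz
    -- Were the nonvanishing set not dense, the determinant would vanish near some point, hence
    -- identically, contradicting its value at `z₀`.
    have h1 : ∀ᶠ y in nhds z, f y = 0 := hz.mono fun y hy => by simpa using hy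
    have h2 := hfa.eqOn_zero_of_preconnected_of_eventuallyEq_zero isPreconnected_univ
      (Set.mem_univ z) h1 (Set.mem_univ z₀)
    simp [hf, hK] at h2
  · intro z hz w hw
    have hu : IsUnit (LinearMap.toMatrix' (K ∘ₗ J z)) :=
      (Matrix.isUnit_iff_isUnit_det _).mpr (isUnit_iff_ne_zero.mpr hz)
    have h1 : (LinearMap.toMatrix' (K ∘ₗ J z)).mulVec w = 0 := by
      rw [LinearMap.toMatrix'_mulVec, LinearMap.comp_apply, hw, map_zero]
    exact Matrix.mulVec_injective_of_isUnit hu (by rw [h1, Matrix.mulVec_zero])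

variable {m N : ℕ} [NeZero m] [NeZero N]

omit [NeZero m] in
theorem dloopChain_add (n : ZMod (m * N)) (z w w' : ZMod (m * N) → ℝ) :
    dloopChain m N n z (w + w') = dloopChain m N n z w + dloopChain m N n z w' :=
  dchain_add _ _ _ m

omit [NeZero m] in
theorem dloopChain_smul (n : ZMod (m * N)) (r : ℝ) (z w : ZMod (m * N) → ℝ) :
    dloopChain m N n z (r • w) = r • dloopChain m N n z w :=
  dchain_smul _ _ r m

theorem exists_immersed (n : ZMod (m * N)) :
    ∃ z₀, ∀ w, dloopChain m N n z₀ w = 0 → w = 0 := by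
  set e := particleEquiv m N (base m N n) with he
  refine ⟨fun a => (((e.symm a).2 : ℕ) : ℝ) + 1, fun w hw => ?_⟩
  have hV : ∀ i < m, ∀ k, slots m N (fun a => (((e.symm a).2 : ℕ) : ℝ) + 1) n i k = (i : ℝ) + 1 := by
    intro i hi k
    have h1 : (m : ZMod (m * N)) * ((k : ℕ) : ZMod (m * N)) + (base m N n + (i : ZMod (m * N)))
        = e (k, ⟨i, hi⟩) := rfl
    rw [slots_eq, h1, Equiv.symm_apply_apply]
  have h2 := eq_zero_of_dchain_eq_zero hV hw
  funext a
  obtain ⟨⟨k, i⟩, rfl⟩ := e.surjective a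
  exact congrFun (h2 i i.2) k

theorem exists_dense_open_immersed (n : ZMod (m * N)) :
    ∃ Ω : Set (ZMod (m * N) → ℝ), IsOpen Ω ∧ Dense Ω ∧
      ∀ z ∈ Ω, ∀ w, dloopChain m N n z w = 0 → w = 0 := by
  let κ := Finset.Icc (-((m : ℤ) + 1)) ((m : ℤ) + 1) × Fin N × Fin N
  let J : (ZMod (m * N) → ℝ) → (ZMod (m * N) → ℝ) →ₗ[ℝ] (κ → ℝ) := fun z =>
    { toFun := fun w x => coord (x.1 : ℤ) x.2.1 x.2.2 (dloopChain m N n z w)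
      map_add' := fun w w' => by
        funext x
        rw [dloopChain_add, coord_add, Pi.add_apply]
      map_smul' := fun r w => by
        funext x
        rw [dloopChain_smul, coord_smul, Pi.smul_apply, smul_eq_mul, RingHom.id_apply] }
  have hJ (z w : ZMod (m * N) → ℝ) (h : J z w = 0) : dloopChain m N n z w = 0 := by
    rw [← sum_coord_smul_elem ((m : ℤ) + 1) _ (coord_dloopChain_eq_zero n z w)]
    refine Finset.sum_eq_zero fun x _ => ?_
    have h1 : coord (x.1 : ℤ) x.2.1 x.2.2 (dloopChain m N n z w) = 0 := congrFun h x
    rw [h1, zero_smul]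
  obtain ⟨z₀, hz₀⟩ := exists_immersed n
  obtain ⟨Ω, h1, h2, h3⟩ := exists_dense_open_injective J
    (fun z w x => analyticAt_coord_dloopChain n z w _ _ _) (z₀ := z₀) fun w hw => hz₀ w (hJ _ _ hw)
  refine ⟨Ω, h1, h2, fun z hz w hw => h3 z hz w ?_⟩
  funext x
  change coord _ _ _ (dloopChain m N n z w) = 0
  rw [hw, coord_zero]

end generic

/-! ### Integrals of motion -/

section determinants

/-- Jacobi's formula. -/
theorem hasDerivAt_det {n : Type*} [Fintype n] [DecidableEq n] {X : ℝ → Matrix n n ℝ}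
    {X' : Matrix n n ℝ} {t : ℝ} (h : ∀ i j, HasDerivAt (fun s => X s i j) (X' i j) t) :
    HasDerivAt (fun s => (X s).det) ((X t).adjugate * X').trace t := by
  simp only [Matrix.det_apply']
  refine (HasDerivAt.fun_sum fun σ _ => (HasDerivAt.fun_finsetProd
    fun i _ => h (σ i) i).const_mul (((Equiv.Perm.sign σ : ℤ) : ℝ))).congr_deriv ?_
  have e (i : n) : ((X t).adjugate * X') i i = ((X t).updateCol i (X'.col i)).det := by
    rw [← Matrix.cramer_apply, Matrix.cramer_eq_adjugate_mulVec]
    rfl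
  simp only [Matrix.trace, Matrix.diag_apply, e, Matrix.det_apply', Finset.mul_sum]
  rw [Finset.sum_comm]
  refine Finset.sum_congr rfl fun i _ => Finset.sum_congr rfl fun σ _ => ?_
  congr 1
  rw [← Finset.prod_erase_mul _ _ (Finset.mem_univ i), smul_eq_mul]
  congr 1
  · refine Finset.prod_congr rfl fun k hk => ?_
    rw [Matrix.updateCol_ne (Finset.ne_of_mem_erase hk)]
  · rw [Matrix.updateCol_self]
    rfl

/-- Subtracting `μ` does not change the commutator. As `Y` and its adjugate multiply to the scalar
`det Y` in either order, the trace of `adj(Y)(YB - BY)` vanishes. -/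
theorem hasDerivAt_det_sub_of_commutator {n : Type*} [Fintype n] [DecidableEq n]
    {X : ℝ → Matrix n n ℝ} {B : Matrix n n ℝ} {t : ℝ}
    (h : ∀ i j, HasDerivAt (fun s => X s i j) ((X t * B - B * X t) i j) t) (μ : ℝ) :
    HasDerivAt (fun s => (X s - μ • 1).det) 0 t := by
  have h1 := hasDerivAt_det (X := fun s => X s - μ • 1) (X' := X t * B - B * X t) (t := t)
    fun i j => by simpa using (h i j).sub_const ((μ • (1 : Matrix n n ℝ)) i j)
  refine h1.congr_deriv ?_
  set Y := X t - μ • (1 : Matrix n n ℝ) with hY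
  have e : X t * B - B * X t = Y * B - B * Y := by
    rw [hY]
    simp [sub_mul, mul_sub]
  rw [e, mul_sub, Matrix.trace_sub, ← mul_assoc, Matrix.adjugate_mul, ← mul_assoc,
    Matrix.trace_mul_comm (_ * B), ← mul_assoc, Matrix.mul_adjugate, sub_self]

end determinants

/-! ### Evaluating the Lax equation at a real spectral parameter -/

section evaluation

variable {N : ℕ}

theorem evalMat_neg (l : ℝˣ) (u : LoopAlg N) : evalMat l (-u) = -evalMat l u := by
  ext i j
  simp only [evalMat, Matrix.of_apply, Matrix.neg_apply, coord_neg, neg_mul, finsum_neg_distrib]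

theorem FinDeg.neg {u : LoopAlg N} (hu : FinDeg u) : FinDeg (-u) := by
  obtain ⟨K, hK⟩ := hu
  exact ⟨K, fun p i j hp => by rw [coord_neg, hK p i j hp, neg_zero]⟩

theorem FinDeg.dg_mul {u : LoopAlg N} (hu : FinDeg u) (d : Fin N → ℝ) : FinDeg (dg d * u) := by
  obtain ⟨K, hK⟩ := hu
  exact ⟨K, fun p i j hp => by rw [coord_dg_mul, hK p i j hp, mul_zero]⟩

theorem FinDeg.mul_dg {u : LoopAlg N} (hu : FinDeg u) (d : Fin N → ℝ) : FinDeg (u * dg d) := by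
  obtain ⟨K, hK⟩ := hu
  exact ⟨K, fun p i j hp => by rw [coord_mul_dg, hK p i j hp, zero_mul]⟩

theorem evalMat_dg_mul (l : ℝˣ) {u : LoopAlg N} (hu : FinDeg u) (d : Fin N → ℝ) :
    evalMat l (dg d * u) = Matrix.diagonal d * evalMat l u := by
  ext i j
  simp only [Matrix.diagonal_mul, evalMat, Matrix.of_apply, coord_dg_mul, mul_assoc]
  rw [mul_finsum' _ _ (hu.finite l _ _)]

theorem evalMat_mul_dg (l : ℝˣ) {u : LoopAlg N} (hu : FinDeg u) (d : Fin N → ℝ) :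
    evalMat l (u * dg d) = evalMat l u * Matrix.diagonal d := by
  ext i j
  simp only [Matrix.mul_diagonal, evalMat, Matrix.of_apply, coord_mul_dg]
  rw [finsum_mul' _ _ (hu.finite l _ _)]
  exact finsum_congr fun p => mul_right_comm _ _ _

variable [NeZero N]

theorem FinDeg.shift_mul {u : LoopAlg N} (hu : FinDeg u) : FinDeg (shift N * u) := by
  obtain ⟨K, hK⟩ := hu
  refine ⟨K + 1, fun p i j hp => ?_⟩
  rw [coord_shift_mul, hK _ _ _ (by rw [lt_abs] at hp ⊢; omega)]

theorem FinDeg.mul_shift {u : LoopAlg N} (hu : FinDeg u) : FinDeg (u * shift N) := by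
  obtain ⟨K, hK⟩ := hu
  refine ⟨K + 1, fun p i j hp => ?_⟩
  rw [coord_mul_shift, hK _ _ _ (by rw [lt_abs] at hp ⊢; omega)]

theorem evalMat_shift_mul (l : ℝˣ) {u : LoopAlg N} (hu : FinDeg u) :
    evalMat l (shift N * u) = shiftMat N l * evalMat l u := by
  ext i j
  rw [shiftMat_mul_apply]
  simp only [evalMat, Matrix.of_apply, coord_shift_mul]
  rw [mul_finsum' _ _ (hu.finite l _ _), ← finsum_comp_equiv (Equiv.addRight (1 : ℤ))]
  refine finsum_congr fun p => ?_
  rw [Equiv.coe_addRight, zpow_add_one₀ l.ne_zero, add_sub_cancel_right]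
  ring

theorem evalMat_mul_shift (l : ℝˣ) {u : LoopAlg N} (hu : FinDeg u) :
    evalMat l (u * shift N) = evalMat l u * shiftMat N l := by
  ext i j
  rw [mul_shiftMat_apply]
  simp only [evalMat, Matrix.of_apply, coord_mul_shift]
  rw [mul_finsum' _ _ (hu.finite l _ _), ← finsum_comp_equiv (Equiv.addRight (1 : ℤ))]
  refine finsum_congr fun p => ?_
  rw [Equiv.coe_addRight, zpow_add_one₀ l.ne_zero, add_sub_cancel_right]
  ring

/-- The Lax pair in terms of the nonnegative part of the loop matrix. -/
theorem commutator_opR_chain (V : ℕ → Fin N → ℝ) (n : ℕ) :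
    chain V n * opR (chain V n) - opR (chain V n) * chain V n
      = chain V n * (shift N + dg fun k => ∑ i ∈ Finset.range n, V i k)
        - (shift N + dg fun k => ∑ i ∈ Finset.range n, V i k) * chain V n := by
  -- `R(L)` is the part of `L` in nonnegative degrees minus `L/2`, and the second term drops out of
  -- the commutator.
  have h : opR (chain V n) = (shift N + dg fun k => ∑ i ∈ Finset.range n, V i k)
      - (1 / 2 : ℝ) • chain V n := by
    apply LoopAlg.ext_coord
    intro p i j
    rw [coord_opR, coord_sub, coord_add, coord_smul, coord_shift, coord_dg]
    rcases lt_or_ge p 0 with h | h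
    · rw [if_neg (by omega), if_neg (by omega), if_neg (by omega)]
      ring
    · rw [if_pos h]
      obtain h1 | h1 | h1 : p = 0 ∨ p = 1 ∨ 1 < p := by omega
      · subst h1
        by_cases hij : i = j
        · subst hij
          rw [coord_chain_zero]
          simp
          ring
        · simp [coord_zero_of_ne _ hij, hij]
      · subst h1
        rw [coord_chain_one]
        split_ifs <;> simp_all
        norm_num
      · rw [coord_chain_of_one_lt V n p i j h1, if_neg (by omega), if_neg (by omega)]
        ring
  rw [h, mul_sub, sub_mul, mul_smul_comm, smul_mul_assoc, sub_sub_sub_cancel_right]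

/-- Once `R(L)` is replaced by the shift plus a diagonal matrix, evaluation has to respect products
with these two kinds of elements only. -/
theorem evalMat_commutator_chain (l : ℝˣ) (V : ℕ → Fin N → ℝ) (n : ℕ) :
    ∃ B : Matrix (Fin N) (Fin N) ℝ,
      evalMat l (chain V n * opR (chain V n) - opR (chain V n) * chain V n)
        = evalMat l (chain V n) * B - B * evalMat l (chain V n) := by
  set d : Fin N → ℝ := fun k => ∑ i ∈ Finset.range n, V i k with hd
  have hu := finDeg_chain V n
  refine ⟨shiftMat N l + Matrix.diagonal d, ?_⟩
  rw [commutator_opR_chain, mul_add, add_mul, sub_eq_add_neg,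
    evalMat_add l (hu.mul_shift.add (hu.mul_dg d)) (hu.shift_mul.add (hu.dg_mul d)).neg,
    evalMat_neg, evalMat_add l hu.mul_shift (hu.mul_dg d),
    evalMat_add l hu.shift_mul (hu.dg_mul d), evalMat_mul_shift l hu, evalMat_mul_dg l hu,
    evalMat_shift_mul l hu, evalMat_dg_mul l hu]
  noncomm_ring

end evaluation

/-! ### Lattice equations, Lax equations and integrals -/

section dynamics

variable {m N : ℕ} [NeZero m] [NeZero N]

theorem hasDerivAt_det_loopMat {z : ℝ → ZMod (m * N) → ℝ} {t : ℝ} (h : SolvesAt m N z t)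
    (n : ZMod (m * N)) (l : ℝˣ) (μ : ℝ) :
    HasDerivAt (fun s => (loopMat m N l (z s) n - μ • 1).det) 0 t := by
  obtain ⟨B, hB⟩ := evalMat_commutator_chain l (slots m N (z t) n) m
  refine hasDerivAt_det_sub_of_commutator (B := B) (fun i j => ?_) μ
  have h1 := dloopChain_latticeField n (z t)
  have h2 := hasCurveDeriv_loopChain h n
  rw [← evalMat_loopChain l n (z t), loopChain, ← hB]
  rw [loopChain] at h1
  rw [← h1, evalMat_eq_sum (coord_dloopChain_eq_zero n (z t) _)]
  simp only [← evalMat_loopChain, evalMat_eq_sum (coord_loopChain_eq_zero n _)]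
  exact HasDerivAt.fun_sum fun p _ => (h2 p i j).mul_const _

theorem laxAt_of_solvesAt {z : ℝ → ZMod (m * N) → ℝ} {t : ℝ} (h : SolvesAt m N z t) {j : ℕ}
    (hj : j ∈ Finset.Icc 1 m) : LaxAt m N j z t := by
  rw [LaxAt]
  simp only [loopL_eq _ hj]
  rw [← dloopChain_latticeField]
  exact hasCurveDeriv_loopChain h _

theorem exists_dense_open_immersed_all (m N : ℕ) [NeZero m] [NeZero N] :
    ∃ Ω : Set (ZMod (m * N) → ℝ), IsOpen Ω ∧ Dense Ω ∧
      ∀ z ∈ Ω, ∀ n w, dloopChain m N n z w = 0 → w = 0 := by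
  choose Ω h1 h2 h3 using exists_dense_open_immersed (m := m) (N := N)
  exact ⟨⋂ n, Ω n, isOpen_iInter_of_finite h1, dense_iInter_of_isOpen h1 h2,
    fun z hz n w => h3 n z (Set.mem_iInter.mp hz n) w⟩

/-- The Lax equation says that the derivative of the family takes equal values on the velocity and
on the lattice field; where that derivative is injective the two coincide. -/
theorem solvesAt_of_laxAt {z : ℝ → ZMod (m * N) → ℝ} {t : ℝ} (hd : DifferentiableAt ℝ z t) {j : ℕ}
    (hj : j ∈ Finset.Icc 1 m) (him : ∀ w, dloopChain m N j (z t) w = 0 → w = 0)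
    (h : LaxAt m N j z t) : SolvesAt m N z t := by
  have hz : ∀ a, HasDerivAt (fun s => z s a) (deriv z t a) t := hasDerivAt_pi.mp hd.hasDerivAt
  rw [LaxAt] at h
  simp only [loopL_eq _ hj] at h
  rw [← dloopChain_latticeField] at h
  have h1 := hasCurveDeriv_loopChain hz (j : ZMod (m * N))
  have h2 : dloopChain m N j (z t) (deriv z t)
      = dloopChain m N j (z t) (latticeField m N (z t)) :=
    LoopAlg.ext_coord fun p a b => (h1 p a b).unique (h p a b)
  have h3 := him (deriv z t + (-1 : ℝ) • latticeField m N (z t)) (by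
    rw [dloopChain_add, dloopChain_smul, h2, neg_one_smul, add_neg_cancel])
  intro a
  have h4 := congrFun h3 a
  simp only [Pi.add_apply, Pi.smul_apply, smul_eq_mul, neg_one_mul, Pi.zero_apply,
    ← sub_eq_add_neg, sub_eq_zero] at h4
  rw [← h4]
  exact hz a

theorem hasCurveDeriv_loopW {z : ℝ → ZMod (m * N) → ℝ} {t : ℝ} (h : SolvesAt m N z t) {j : ℕ}
    (hj : j ∈ Finset.Icc 1 m) :
    HasCurveDeriv (fun s => loopW m N j (z s))
      (loopW m N j (z t) * opR (loopL m N (cycPred m j) (z t))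
        - opR (loopL m N j (z t)) * loopW m N j (z t)) t := by
  rw [loopL_eq _ hj, loopL_eq _ (cycPred_mem hj)]
  have hv (n : ZMod (m * N)) (k : Fin N) :
      HasDerivAt (fun s => slot m N (z s) n k) (slot m N (latticeField m N (z t)) n k) t := h _
  by_cases h1 : j = 1
  · subst h1
    simp only [loopW, if_true, loopU_eq, cycPred, Nat.cast_one]
    -- The shift in `U₁` carries `R(L_m)` to `R` of the loop matrix with index `0`, so the case `j =
    -- 1` reduces to the elementary factor `Q_1`.
    have hs := opR_shift _ _ (shift_mul_loopChain (m : ZMod (m * N)) (z t))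
    have hstep := step_opR_loopChain (1 : ZMod (m * N)) (z t)
    rw [mul_assoc, hs, sub_self, ← mul_assoc, ← mul_assoc, ← sub_mul]
    rw [sub_self] at hstep
    rw [hstep]
    intro p a b
    simp only [coord_mul_shift, coord_add, coord_low]
    split_ifs with hc
    · exact (hv _ _).const_add _
    · exact (hasDerivAt_const t (0 : ℝ)).const_add _
  · simp only [loopW, if_neg h1, loopV_eq]
    rw [cast_cycPred hj h1, step_opR_loopChain]
    intro p a b
    simp only [coord_add, coord_low]
    split_ifs with hc
    · exact (hv _ _).const_add _
    · exact (hasDerivAt_const t (0 : ℝ)).const_add _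

theorem det_matL_eq {R : Type*} [CommRing R] (l : Rˣ) (z : ZMod (m * N) → R) (μ : R) {j : ℕ}
    (hj : j ∈ Finset.Icc 1 m) :
    (matL m N l z j - μ • 1).det = (loopMat m N l z 0 - μ • 1).det := by
  rw [matL_eq l z hj, det_loopMat_eq]

theorem det_matT_pow_eq_prod {R : Type*} [CommRing R] (l : Rˣ) (z : ZMod (m * N) → R) (μ : R) :
    (matT m N l z ^ m - μ • 1).det
      = ∏ j ∈ Finset.Icc 1 m, (matL m N (l ^ m) z j - μ • 1).det := by
  rw [det_matT_pow, Finset.prod_congr rfl fun j hj => det_matL_eq (l ^ m) z μ hj, Finset.prod_const,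
    Nat.card_Icc, Nat.add_sub_cancel]
  have h (i : Fin m) : (loopMat m N (l ^ m) z (1 + ((i : ℕ) : ZMod (m * N))) - μ • 1).det
      = (loopMat m N (l ^ m) z 0 - μ • 1).det := by
    rw [← det_loopMat_eq (l ^ m) z (1 + i), Nat.cast_add, Nat.cast_one]
  simp [h]

end dynamics

end Bogoyavlensky

end

theorem theorem2 (m N : ℕ) [NeZero m] [NeZero N] :
    -- the matrices `L_j` form a Poisson submanifold
    (∀ j ∈ Finset.Icc 1 m,
      Bogoyavlensky.IsPoissonSubmanifold
        Bogoyavlensky.opA Bogoyavlensky.opB Bogoyavlensky.opC Bogoyavlensky.opD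
        (Bogoyavlensky.latticeBracket m N) (Bogoyavlensky.loopL m N j)) ∧
    -- the lattice equations imply all the Lax equations
    (∀ (z : ℝ → ZMod (m * N) → ℝ) (t : ℝ), Bogoyavlensky.SolvesAt m N z t →
      ∀ j ∈ Finset.Icc 1 m, Bogoyavlensky.LaxAt m N j z t) ∧
    -- on a dense open set each of the Lax equations is equivalent to the lattice equations
    (∃ Ω : Set (ZMod (m * N) → ℝ), IsOpen Ω ∧ Dense Ω ∧
      ∀ (z : ℝ → ZMod (m * N) → ℝ) (t : ℝ), DifferentiableAt ℝ z t → z t ∈ Ω →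
        ∀ j ∈ Finset.Icc 1 m,
          (Bogoyavlensky.LaxAt m N j z t ↔ Bogoyavlensky.SolvesAt m N z t)) ∧
    -- the Lax representations are gauge equivalent by means of the factors `U_1, V_2, …, V_m`
    (∀ j ∈ Finset.Icc 1 m,
      (∀ z : ZMod (m * N) → ℝ, IsUnit (Bogoyavlensky.loopW m N j z) ∧
        Bogoyavlensky.loopL m N j z * Bogoyavlensky.loopW m N j z =
          Bogoyavlensky.loopW m N j z * Bogoyavlensky.loopL m N (Bogoyavlensky.cycPred m j) z) ∧
      ∀ (z : ℝ → ZMod (m * N) → ℝ) (t : ℝ), Bogoyavlensky.SolvesAt m N z t →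
        Bogoyavlensky.HasCurveDeriv (fun s => Bogoyavlensky.loopW m N j (z s))
          (Bogoyavlensky.loopW m N j (z t) *
              Bogoyavlensky.opR (Bogoyavlensky.loopL m N (Bogoyavlensky.cycPred m j) (z t)) -
            Bogoyavlensky.opR (Bogoyavlensky.loopL m N j (z t)) *
              Bogoyavlensky.loopW m N j (z t)) t) ∧
    -- the characteristic polynomials: integrals of motion, factorization, equal factors
    (∀ (z : ℝ → ZMod (m * N) → ℝ) (t : ℝ), Bogoyavlensky.SolvesAt m N z t →
      ∀ j ∈ Finset.Icc 1 m, ∀ (l : ℝˣ) (μ : ℝ),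
        HasDerivAt (fun s => (Bogoyavlensky.matL m N l (z s) j - μ • 1).det) 0 t) ∧
    (∀ (R : Type*) [CommRing R] (z : ZMod (m * N) → R) (l : Rˣ) (μ : R),
      (Bogoyavlensky.matT m N l z ^ m - μ • 1).det =
          ∏ j ∈ Finset.Icc 1 m, (Bogoyavlensky.matL m N (l ^ m) z j - μ • 1).det ∧
      ∀ i ∈ Finset.Icc 1 m, ∀ j ∈ Finset.Icc 1 m,
        (Bogoyavlensky.matL m N (l ^ m) z i - μ • 1).det =
          (Bogoyavlensky.matL m N (l ^ m) z j - μ • 1).det) := by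
  obtain ⟨Ω, ho, hde, him⟩ := Bogoyavlensky.exists_dense_open_immersed_all m N
  refine ⟨fun j hj => ?_, fun z t h j hj => Bogoyavlensky.laxAt_of_solvesAt h hj,
    ⟨Ω, ho, hde, fun z t hd hz j hj => ⟨Bogoyavlensky.solvesAt_of_laxAt hd hj (him _ hz _),
      fun h => Bogoyavlensky.laxAt_of_solvesAt h hj⟩⟩,
    fun j hj => ⟨fun z => ⟨Bogoyavlensky.isUnit_loopW z j, Bogoyavlensky.loopL_mul_loopW z hj⟩,
      fun z t h => Bogoyavlensky.hasCurveDeriv_loopW h hj⟩,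
    fun z t h j hj l μ => ?_,
    fun R _ z l μ => ⟨Bogoyavlensky.det_matT_pow_eq_prod l z μ, fun i hi j hj => ?_⟩⟩
  · rw [show Bogoyavlensky.loopL m N j = Bogoyavlensky.loopChain m N j from
      funext fun z => Bogoyavlensky.loopL_eq z hj]
    exact Bogoyavlensky.isPoissonSubmanifold_loopChain _ ho hde fun z hz => him z hz _
  · simp only [Bogoyavlensky.matL_eq l _ hj]
    exact Bogoyavlensky.hasDerivAt_det_loopMat h _ l μ
  · rw [Bogoyavlensky.det_matL_eq _ z μ hi, Bogoyavlensky.det_matL_eq _ z μ hj]
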